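/- Let $\hbar$ be a formal parameter, let $P[[x,p,\hbar]]$ be the space of formal power series in $x,p,\hbar$ over $\mathbb C$, and let $f(y)=\sum_{k\ge 0}f_ky^k\in\mathbb C[[y]]$ with $f_0=1$. Put $$\alpha(y)=f(y)\,e^{iy/2},\qquad \hat\alpha=\alpha\!\left(-\hbar\frac{\partial^2}{\partial x\,\partial p}\right),\qquad A\ast_g B=\hat\alpha^{-1}\big[(\hat\alpha A)\ast(\hat\alpha B)\big],$$ where $A\ast B=A\exp\{\tfrac{i\hbar}{2}\overleftrightarrow{\mathcal P}\}B$ is the Moyal product, $A\overleftrightarrow{\mathcal P}B=\partial_xA\,\partial_pB-\partial_pA\,\partial_xB$. Let $\widehat P[[\hat x,\hat p,\hbar]]$ be the algebra of formal power series in $\hat x,\hat p,\hbar$, with $\hbar$ central and $[\hat x,\hat p]=i\hbar$ (the non-commutative formal power series modulo the smallest closed two-sided ideal containing $\hat x\hat p-\hat p\hat x-i\hbar$), and let $W_g:P[[x,p,\hbar]]\to\widehat P[[\hat x,\hat p,\hbar]]$ be the generalized Weyl map: the $\mathbb C[[\hbar]]$-linear map, extended to formal series, with $$W_g(p^mx^n)=\sum_{s=0}^{\min(m,n)}g(m,n,s)\,\hbar^s\,\hat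 p^{\,m-s}\hat x^{\,n-s},\qquad g(m,n,s)=\frac{(-1)^s\,m!\,n!}{s!\,(m-s)!\,(n-s)!}\,f^{(s)}(0).$$ Let $\hat a,\hat a^\dagger$ be the destruction and creation operators on formal series $\sum_{j\ge 0}\psi_j|j\rangle$, $\psi_j\in\mathbb C[[\hbar]]$: $\hat a|j\rangle=\sqrt j\,|j-1\rangle$, $\hat a^\dagger|j\rangle=\sqrt{j+1}\,|j+1\rangle$. Let $\widehat P[[\hat a^\dagger,-i\hbar\hat a,\hbar]]$ be the set of operators that are formal power series in the non-commuting operators $\hat a^\dagger$, $-i\hbar\hat a$ and in $\hbar$. Let $a,a^\dagger$ be the standard infinite matrices, $a_{j,j+1}=(a^\dagger)_{j+1,j}=\sqrt j$ for $j\ge 1$, all other entries $0$, and let $P[[a^\dagger,-i\hbar a,\hbar]]$ be the set of infinite matrices over $\mathbb C[[\hbar]]$ that are formal power series in $a^\dagger$, $-i\hbar a$, $\hbar$ (entries of series and of products are formally convergent sums in $\mathbb C[[\hbar]]$). Put $F^{(m,n)}=(-i\hbar a)^m(a^\dagger)^n$. Then: 1. $\widehat P[[\hat a^\dagger,-i\hbar\hat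 a,\hbar]]$ and $P[[a^\dagger,-i\hbar a,\hbar]]$ are algebras over $\mathbb C[[\hbar]]$. The substitution $L(\hat x)=\hat a^\dagger$, $L(\hat p)=-i\hbar\hat a$ is a well defined algebra isomorphism $L:\widehat P[[\hat x,\hat p,\hbar]]\to\widehat P[[\hat a^\dagger,-i\hbar\hat a,\hbar]]$. The substitution of the matrices $a,a^\dagger$ for $\hat a,\hat a^\dagger$ is a well defined algebra isomorphism $\rho:\widehat P[[\hat a^\dagger,-i\hbar\hat a,\hbar]]\to P[[a^\dagger,-i\hbar a,\hbar]]$. 2. The operator $\hat\alpha$ is invertible with inverse $\frac1\alpha\big(-\hbar\frac{\partial^2}{\partial x\,\partial p}\big)$, the product $\ast_g$ is associative with unit $1$, and $W_g$ is a linear bijection with $W_g(1)=1$ and $W_g(A)W_g(B)=W_g(A\ast_gB)$. Moreover $$L(W_g(p^mx^n))=\sum_{s=0}^{\min(m,n)}\frac{(-\hbar)^s\,m!\,n!}{s!\,(m-s)!\,(n-s)!}\,f^{(s)}(0)\,(-i\hbar\hat a)^{m-s}(\hat a^\dagger)^{n-s}.$$ 3. Hence $\widetilde{W_g}=\rho\circ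 L\circ W_g$ is an algebra isomorphism from $(P[[x,p,\hbar]],\ast_g)$ onto $P[[a^\dagger,-i\hbar a,\hbar]]$: it is linear, bijective, unital, and $\widetilde{W_g}(A\ast_gB)=\widetilde{W_g}(A)\,\widetilde{W_g}(B)$. For all $m,n\ge 0$, $$\widetilde{W_g}(p^mx^n)=\sum_{s=0}^{\min(m,n)}\frac{(-\hbar)^s\,m!\,n!}{s!\,(m-s)!\,(n-s)!}\,f^{(s)}(0)\,F^{(m-s,n-s)}.$$ 4. In particular, for all $m,n\ge 0$: - (Weyl ordering) if $\alpha(y)=1$, then $\ast_g=\ast$, $W_g((ux+vp)^N)=(u\hat x+v\hat p)^N$ for all $u,v\in\mathbb C[[\hbar]]$ and $N\ge 0$, and $\widetilde{W_g}(p^mx^n)=\sum_{s=0}^{\min(m,n)}\frac{(i\hbar)^s\,m!\,n!}{2^s\,s!\,(m-s)!\,(n-s)!}F^{(m-s,n-s)}$; - (standard ordering) if $\alpha(y)=e^{-iy/2}$, then $W_g(p^mx^n)=\hat x^n\hat p^m$ and $\widetilde{W_g}(p^mx^n)=\sum_{s=0}^{\min(m,n)}\frac{(i\hbar)^s\,m!\,n!}{s!\,(m-s)!\,(n-s)!}F^{(m-s,n-s)}$;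 - (anti-standard ordering) if $\alpha(y)=e^{iy/2}$, then $W_g(p^mx^n)=\hat p^m\hat x^n$ and $\widetilde{W_g}(p^mx^n)=F^{(m,n)}$; - (symmetric ordering) if $\alpha(y)=\cos(y/2)$, then $W_g(p^mx^n)=\frac12(\hat p^m\hat x^n+\hat x^n\hat p^m)$ and $\widetilde{W_g}(p^mx^n)=F^{(m,n)}+\sum_{s=1}^{\min(m,n)}\frac{(i\hbar)^s\,m!\,n!}{2\,s!\,(m-s)!\,(n-s)!}F^{(m-s,n-s)}$; - (Born–Jordan ordering) if $\alpha(y)=\frac{\sin(y/2)}{y/2}$, then $W_g(p^mx^n)=\frac1{m+1}\sum_{k=0}^m\hat p^k\hat x^n\hat p^{m-k}$ and $\widetilde{W_g}(p^mx^n)=\sum_{s=0}^{\min(m,n)}\frac{(i\hbar)^s\,m!\,n!}{(s+1)!\,(m-s)!\,(n-s)!}F^{(m-s,n-s)}$. -/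

import Mathlib

noncomputable section

namespace Moyal

/-! ### Formal series in the deformation parameter -/

/-- The ring `ℂ[[ħ]]` of formal power series in the deformation parameter. -/
abbrev HSer : Type := PowerSeries ℂ

/-- The deformation parameter `ħ`. -/
abbrev hbar : HSer := PowerSeries.X

/-- A complex number, seen as a constant series in `ħ`. -/
abbrev cst (z : ℂ) : HSer := PowerSeries.C z

/-- `s = ∑ i, t i` as a formal sum: for every power of `ħ` only finitely many `t i` contribute to
its coefficient, and their contributions add up to the coefficient of `s`. -/
def HasFormalSum {ι : Type} (t : ι → HSer) (s : HSer) : Prop :=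
  ∀ K : ℕ, (Function.support fun i => PowerSeries.coeff K (t i)).Finite ∧
    PowerSeries.coeff K s = ∑ᶠ i, PowerSeries.coeff K (t i)

/-! ### The phase space series and the generalized Moyal product -/

/-- `P[[x, p, ħ]]`, written as `ℂ[[ħ]][[x, p]]`; the variable `0` is `x`, the variable `1` is
`p`. -/
abbrev Phase : Type := MvPowerSeries (Fin 2) HSer

/-- The coordinate `x`. -/
abbrev xv : Phase := MvPowerSeries.X 0

/-- The coordinate `p`. -/
abbrev pv : Phase := MvPowerSeries.X 1

/-- `∂/∂x`. -/
abbrev dx (A : Phase) : Phase := MvPowerSeries.pderiv HSer 0 A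

/-- `∂/∂p`. -/
abbrev dp (A : Phase) : Phase := MvPowerSeries.pderiv HSer 1 A

/-- The formal sum `∑ r, ħ ^ r * T r`, which exists for every sequence `T` in `P[[x, p, ħ]]`:
the coefficient of `ħ ^ K` collects the coefficients of `ħ ^ (K - r)` in `T r` for `r ≤ K`. -/
def hbarSum (T : ℕ → Phase) : Phase := fun e =>
  PowerSeries.mk fun K =>
    ∑ r ∈ Finset.range (K + 1), PowerSeries.coeff (K - r) (MvPowerSeries.coeff e (T r))

/-- The operator `φ(-ħ ∂²/∂x∂p) = ∑ s, φ_s (-ħ)^s (∂²/∂x∂p)^s` for a series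
`φ(y) = ∑ s, φ_s y^s`. -/
def diffOp (φ : PowerSeries ℂ) (A : Phase) : Phase :=
  hbarSum fun s => cst ((-1) ^ s * PowerSeries.coeff s φ) • (fun B => dx (dp B))^[s] A

/-- The `r`-th power `A P^r B` of the Poisson bidifferential operator
`A P B = ∂A/∂x ∂B/∂p - ∂A/∂p ∂B/∂x`. -/
def poissonPow : ℕ → Phase → Phase → Phase
  | 0, A, B => A * B
  | r + 1, A, B => poissonPow r (dx A) (dp B) - poissonPow r (dp A) (dx B)

/-- The Moyal product `A exp((iħ/2) P) B`. -/
def moyal (A B : Phase) : Phase :=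
  hbarSum fun r => cst ((Complex.I / 2) ^ r / (r.factorial : ℂ)) • poissonPow r A B

/-- The series `exp (c y)`. -/
def expSer (c : ℂ) : PowerSeries ℂ := PowerSeries.rescale c (PowerSeries.exp ℂ)

/-- The series `α(y) = f(y) exp(i y / 2)`. -/
def alpha (f : PowerSeries ℂ) : PowerSeries ℂ := f * expSer (Complex.I / 2)

/-- The generalized Moyal product `A ∗_g B = α̂⁻¹ ((α̂ A) ∗ (α̂ B))` with
`α̂ = α(-ħ ∂²/∂x∂p)`. -/
def gstar (f : PowerSeries ℂ) (A B : Phase) : Phase :=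
  diffOp (alpha f)⁻¹ (moyal (diffOp (alpha f) A) (diffOp (alpha f) B))

/-- The value at `0` of the `s`-th derivative of a formal series. -/
def derivZero (f : PowerSeries ℂ) (s : ℕ) : ℂ :=
  PowerSeries.constantCoeff ((PowerSeries.derivative ℂ)^[s] f)

/-- The number `g(m, n, s) = (-1)^s m! n! / (s! (m-s)! (n-s)!) f^(s)(0)`, for `s ≤ min m n`. -/
def gcoef (f : PowerSeries ℂ) (m n s : ℕ) : ℂ :=
  (-1) ^ s * (m.factorial : ℂ) * (n.factorial : ℂ) /
    ((s.factorial : ℂ) * ((m - s).factorial : ℂ) * ((n - s).factorial : ℂ)) * derivZero f s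

/-! ### Formal power series in two non-commuting letters and `ħ` -/

/-- Formal power series in two non-commuting letters `0` and `1` and the central variable `ħ`:
a coefficient in `ℂ[[ħ]]` for every word. -/
def NC : Type := List (Fin 2) → HSer

namespace NC

instance : AddCommGroup NC := inferInstanceAs (AddCommGroup (List (Fin 2) → HSer))

instance : Module HSer NC := inferInstanceAs (Module HSer (List (Fin 2) → HSer))

instance : One NC := ⟨fun w => if w = [] then 1 else 0⟩

/-- The Cauchy product: sum over all ways to cut a word in two. -/
instance : Mul NC :=
  ⟨fun c d w => ∑ i ∈ Finset.range (w.length + 1), c (w.take i) * d (w.drop i)⟩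

theorem ext {c d : NC} (h : ∀ w, c w = d w) : c = d := funext h

theorem add_apply (c d : NC) (w : List (Fin 2)) : (c + d) w = c w + d w := rfl

theorem zero_apply (w : List (Fin 2)) : (0 : NC) w = 0 := rfl

theorem smul_apply (r : HSer) (c : NC) (w : List (Fin 2)) : (r • c) w = r * c w := rfl

theorem one_apply (w : List (Fin 2)) : (1 : NC) w = if w = [] then 1 else 0 := rfl

theorem mul_apply (c d : NC) (w : List (Fin 2)) :
    (c * d) w = ∑ i ∈ Finset.range (w.length + 1), c (w.take i) * d (w.drop i) := rfl

/-- The series with coefficients `c (a w)`. -/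
def left (a : Fin 2) (c : NC) : NC := fun v => c (a :: v)

theorem left_apply (a : Fin 2) (c : NC) (v : List (Fin 2)) : left a c v = c (a :: v) := rfl

theorem mul_nil (c d : NC) : (c * d) [] = c [] * d [] := by
  simp [mul_apply]

theorem mul_cons (c d : NC) (a : Fin 2) (w : List (Fin 2)) :
    (c * d) (a :: w) = c [] * d (a :: w) + (left a c * d) w := by
  rw [mul_apply, List.length_cons, Finset.sum_range_succ', mul_apply]
  simp [add_comm, left_apply]

protected theorem add_mul' (c d e : NC) : (c + d) * e = c * e + d * e := by
  apply ext
  intro w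
  simp only [mul_apply, add_apply, add_mul, Finset.sum_add_distrib]

protected theorem mul_add' (c d e : NC) : c * (d + e) = c * d + c * e := by
  apply ext
  intro w
  simp only [mul_apply, add_apply, mul_add, Finset.sum_add_distrib]

protected theorem smul_mul' (r : HSer) (c d : NC) : (r • c) * d = r • (c * d) := by
  apply ext
  intro w
  simp only [mul_apply, smul_apply, Finset.mul_sum, mul_assoc]

protected theorem mul_smul' (r : HSer) (c d : NC) : c * (r • d) = r • (c * d) := by
  apply ext
  intro w
  simp only [mul_apply, smul_apply, Finset.mul_sum]
  exact Finset.sum_congr rfl fun _ _ => by ring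

protected theorem zero_mul' (c : NC) : 0 * c = 0 := by
  apply ext
  intro w
  simp [mul_apply, zero_apply]

protected theorem mul_zero' (c : NC) : c * 0 = 0 := by
  apply ext
  intro w
  simp [mul_apply, zero_apply]

protected theorem mul_assoc' (c d e : NC) : c * d * e = c * (d * e) := by
  apply ext
  intro w
  induction w generalizing c d with
  | nil => simp only [mul_nil, mul_assoc]
  | cons a w ih =>
    have h : left a (c * d) = c [] • left a d + left a c * d := by
      apply ext
      intro v
      rw [add_apply, smul_apply]
      exact mul_cons c d a v
    rw [mul_cons (c * d), h, NC.add_mul', add_apply, NC.smul_mul', smul_apply, ih,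
      mul_cons c (d * e), mul_cons d e, mul_nil]
    ring

protected theorem one_mul' (c : NC) : 1 * c = c := by
  apply ext
  intro w
  cases w with
  | nil => simp [mul_nil, one_apply]
  | cons a w =>
    have h : left a (1 : NC) = 0 := by
      apply ext
      intro v
      simp [left_apply, one_apply, zero_apply]
    rw [mul_cons, h, NC.zero_mul', zero_apply, one_apply]
    simp

protected theorem mul_one' (c : NC) : c * 1 = c := by
  apply ext
  intro w
  induction w generalizing c with
  | nil => simp [mul_nil, one_apply]
  | cons a w ih =>
    rw [mul_cons, ih, one_apply]
    simp [left_apply]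

instance : Ring NC :=
  { (inferInstance : AddCommGroup NC), (inferInstance : Mul NC), (inferInstance : One NC) with
    left_distrib := NC.mul_add'
    right_distrib := NC.add_mul'
    zero_mul := NC.zero_mul'
    mul_zero := NC.mul_zero'
    mul_assoc := NC.mul_assoc'
    one_mul := NC.one_mul'
    mul_one := NC.mul_one' }

instance : Algebra HSer NC :=
  Algebra.ofModule NC.smul_mul' (fun r c d => NC.mul_smul' r c d)

/-- The letter `i` as a series. -/
def letter (i : Fin 2) : NC := fun w => if w = [i] then 1 else 0

end NC

/-! ### The operator algebra of `x̂`, `p̂`, `ħ` -/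

/-- A two-sided ideal that is closed under limits of formal power series: it contains every series
that agrees with elements of the ideal up to arbitrarily high total degree in the letters
and `ħ`. -/
def IsFormallyClosed (I : TwoSidedIdeal NC) : Prop :=
  ∀ c : NC, (∀ N : ℕ, ∃ d ∈ I, ∀ (w : List (Fin 2)) (k : ℕ), w.length + k < N →
    PowerSeries.coeff k (c w) = PowerSeries.coeff k (d w)) → c ∈ I

/-- The smallest closed two-sided ideal that contains `x p - p x - i ħ`. -/
def heisIdeal : TwoSidedIdeal NC :=
  sInf {I | IsFormallyClosed I ∧
    NC.letter 0 * NC.letter 1 - NC.letter 1 * NC.letter 0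
      - (cst Complex.I * hbar) • (1 : NC) ∈ I}

/-- The algebra of formal power series in `x̂`, `p̂`, `ħ` subject to `[x̂, p̂] = i ħ`: the completed
enveloping algebra of the Heisenberg-Weyl algebra. -/
abbrev Heis : Type := heisIdeal.ringCon.Quotient

/-- The element of the operator algebra that a non-commutative formal series in `x̂` (letter `0`),
`p̂` (letter `1`) and `ħ` represents. -/
def Heis.mk (c : NC) : Heis := heisIdeal.ringCon.mk' c

/-- The position operator. -/
def xhat : Heis := Heis.mk (NC.letter 0)

/-- The momentum operator. -/
def phat : Heis := Heis.mk (NC.letter 1)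

/-- Replace every `p^m x^n` of a phase space series by the word `p⋯p x⋯x`. -/
def normalOrder (B : Phase) : NC := fun w =>
  if w = List.replicate (w.count 1) 1 ++ List.replicate (w.count 0) 0 then
    MvPowerSeries.coeff (Finsupp.single 0 (w.count 0) + Finsupp.single 1 (w.count 1)) B
  else 0

/-- The generalized Weyl map, with the values
`W_g(p^m x^n) = ∑ s, g(m, n, s) ħ^s p̂^(m-s) x̂^(n-s)` on monomials, on arbitrary formal series:
for `A = ∑ A_{m,n} p^m x^n`, the coefficient of `p̂^M x̂^N` in `W_g(A)` is
`∑ s, ħ^s g(M+s, N+s, s) A_{M+s,N+s}`. -/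
def weylMap (f : PowerSeries ℂ) (A : Phase) : Heis :=
  Heis.mk (normalOrder (hbarSum fun s => fun e =>
    cst (gcoef f (e 1 + s) (e 0 + s) s) *
      MvPowerSeries.coeff (e + Finsupp.single 0 s + Finsupp.single 1 s) A))

/-! ### Creation and destruction operators -/

/-- Formal state vectors `∑ j, ψ_j |j⟩` in the number basis, with coefficients in `ℂ[[ħ]]`. -/
abbrev Fock : Type := ℕ → HSer

/-- The destruction operator: `â |j+1⟩ = √(j+1) |j⟩`, `â |0⟩ = 0`. -/
def destr : Module.End HSer Fock where
  toFun ψ j := cst (Real.sqrt (j + 1) : ℝ) * ψ (j + 1)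
  map_add' ψ χ := by funext j; simp [mul_add]
  map_smul' r ψ := by funext j; simp [mul_left_comm]

/-- The creation operator: `â† |j⟩ = √(j+1) |j+1⟩`. -/
def creat : Module.End HSer Fock where
  toFun ψ j := cst (Real.sqrt j : ℝ) * ψ (j - 1)
  map_add' ψ χ := by funext j; simp [mul_add]
  map_smul' r ψ := by funext j; simp [mul_left_comm]

/-- The operator `-i ħ â`. -/
def momOp : Module.End HSer Fock := (cst (-Complex.I) * hbar) • destr

/-- The operator `T` is the value of the non-commutative formal series `c` at `â†` (letter `0`)
and `-i ħ â` (letter `1`). -/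
def IsOpSeries (c : NC) (T : Module.End HSer Fock) : Prop :=
  ∀ (ψ : Fock) (j : ℕ), HasFormalSum
    (fun w : List (Fin 2) => c w * (w.map ![creat, momOp]).prod ψ j) (T ψ j)

/-- The operators that are formal power series in `â†`, `-i ħ â`, `ħ`. -/
def opSeriesSet : Set (Module.End HSer Fock) := {T | ∃ c : NC, IsOpSeries c T}

/-! ### Infinite matrices -/

/-- The infinite matrices over `ℂ[[ħ]]` whose entry in row `j` and column `l` is divisible by
`ħ^(l-j)` when `l > j`. For these, every matrix product converges as a formal series in `ħ`.
Rows and columns are numbered from `0`. -/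
def bandedSubmodule : Submodule HSer (Matrix ℕ ℕ HSer) where
  carrier := {A | ∀ j l, hbar ^ (l - j) ∣ A j l}
  add_mem' hA hB j l := dvd_add (hA j l) (hB j l)
  zero_mem' _ _ := dvd_zero _
  smul_mem' r _ hA j l := Dvd.dvd.mul_left (hA j l) r

/-- The type of these matrices. -/
def HMat : Type := bandedSubmodule

namespace HMat

instance : AddCommGroup HMat := inferInstanceAs (AddCommGroup bandedSubmodule)

instance : Module HSer HMat := inferInstanceAs (Module HSer bandedSubmodule)

/-- The entry of a matrix in row `j` and column `l`. -/
def entry (A : HMat) (j l : ℕ) : HSer := A.1 j l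

theorem ext {A B : HMat} (h : ∀ j l, A.entry j l = B.entry j l) : A = B :=
  Subtype.ext (Matrix.ext h)

theorem entry_add (A B : HMat) (j l : ℕ) : (A + B).entry j l = A.entry j l + B.entry j l := rfl

theorem entry_zero (j l : ℕ) : (0 : HMat).entry j l = 0 := rfl

theorem entry_smul (r : HSer) (A : HMat) (j l : ℕ) : (r • A).entry j l = r * A.entry j l := rfl

theorem coeff_entry (A : HMat) {j l K : ℕ} (h : j + K < l) :
    PowerSeries.coeff K (A.entry j l) = 0 :=
  PowerSeries.X_pow_dvd_iff.mp (A.2 j l) K (by omega)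

theorem coeff_entry_mul (A : HMat) (r : HSer) {j l K : ℕ} (h : j + K < l) :
    PowerSeries.coeff K (A.entry j l * r) = 0 :=
  PowerSeries.X_pow_dvd_iff.mp (Dvd.dvd.mul_right (A.2 j l) r) K (by omega)

/-- The entry `∑ l, A_{jl} B_{lk}` of a matrix product, summed for each power of `ħ`. -/
def mulEntry (A B : HMat) (j k : ℕ) : HSer :=
  PowerSeries.mk fun K => ∑ᶠ l, PowerSeries.coeff K (A.entry j l * B.entry l k)

theorem support_subset (A B : HMat) (j k K N : ℕ) (h : j + K < N) :
    (Function.support fun l => PowerSeries.coeff K (A.entry j l * B.entry l k))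
      ⊆ (Finset.range N : Finset ℕ) := by
  intro l hl
  by_contra hn
  exact hl (A.coeff_entry_mul _ (by simp at hn; omega))

theorem hasFormalSum_mulEntry (A B : HMat) (j k : ℕ) :
    HasFormalSum (fun l => A.entry j l * B.entry l k) (mulEntry A B j k) := by
  intro K
  refine ⟨(Finset.finite_toSet _).subset (support_subset A B j k K (j + K + 1) (by omega)), ?_⟩
  rw [mulEntry, PowerSeries.coeff_mk]

theorem coeff_mulEntry (A B : HMat) (j k K N : ℕ) (h : j + K < N) :
    PowerSeries.coeff K (mulEntry A B j k)
      = PowerSeries.coeff K (∑ l ∈ Finset.range N, A.entry j l * B.entry l k) := by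
  rw [mulEntry, PowerSeries.coeff_mk, map_sum,
    finsum_eq_sum_of_support_subset _ (support_subset A B j k K N h)]

theorem mulEntry_mem (A B : HMat) (j k : ℕ) : hbar ^ (k - j) ∣ mulEntry A B j k := by
  rw [PowerSeries.X_pow_dvd_iff]
  intro K hK
  rw [coeff_mulEntry A B j k K (j + K + 1) (by omega), map_sum]
  refine Finset.sum_eq_zero fun l _ => ?_
  have h : hbar ^ (k - j) ∣ A.entry j l * B.entry l k :=
    (pow_dvd_pow hbar (show k - j ≤ (l - j) + (k - l) by omega)).trans
      (by rw [pow_add]; exact mul_dvd_mul (A.2 j l) (B.2 l k))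
  exact PowerSeries.X_pow_dvd_iff.mp h K hK

/-- The matrix product. -/
instance : Mul HMat := ⟨fun A B => ⟨Matrix.of (mulEntry A B), mulEntry_mem A B⟩⟩

instance : One HMat := ⟨⟨1, fun j l => by
  rcases eq_or_ne j l with h | h
  · simp [h]
  · rw [Matrix.one_apply_ne h]; exact dvd_zero _⟩⟩

theorem entry_mul (A B : HMat) (j k : ℕ) : (A * B).entry j k = mulEntry A B j k := rfl

theorem entry_one (j l : ℕ) : (1 : HMat).entry j l = if j = l then 1 else 0 :=
  Matrix.one_apply

theorem coeff_mul_entry (A B : HMat) (j k K N : ℕ) (h : j + K < N) :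
    PowerSeries.coeff K ((A * B).entry j k)
      = PowerSeries.coeff K (∑ l ∈ Finset.range N, A.entry j l * B.entry l k) :=
  coeff_mulEntry A B j k K N h

protected theorem add_mul' (A B C : HMat) : (A + B) * C = A * C + B * C := by
  apply ext
  intro j k
  apply PowerSeries.ext
  intro K
  rw [entry_add, map_add]
  simp only [coeff_mul_entry _ _ j k K (j + K + 1) (by omega), ← map_add,
    ← Finset.sum_add_distrib, entry_add, add_mul]

protected theorem mul_add' (A B C : HMat) : A * (B + C) = A * B + A * C := by
  apply ext
  intro j k
  apply PowerSeries.ext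
  intro K
  rw [entry_add, map_add]
  simp only [coeff_mul_entry _ _ j k K (j + K + 1) (by omega), ← map_add,
    ← Finset.sum_add_distrib, entry_add, mul_add]

protected theorem zero_mul' (A : HMat) : 0 * A = 0 := by
  apply ext
  intro j k
  apply PowerSeries.ext
  intro K
  rw [coeff_mul_entry _ _ j k K (j + K + 1) (by omega)]
  simp [entry_zero]

protected theorem mul_zero' (A : HMat) : A * 0 = 0 := by
  apply ext
  intro j k
  apply PowerSeries.ext
  intro K
  rw [coeff_mul_entry _ _ j k K (j + K + 1) (by omega)]
  simp [entry_zero]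

protected theorem one_mul' (A : HMat) : 1 * A = A := by
  apply ext
  intro j k
  apply PowerSeries.ext
  intro K
  rw [coeff_mul_entry _ _ j k K (j + K + 1) (by omega)]
  simp only [entry_one, ite_mul, one_mul, zero_mul, Finset.sum_ite_eq]
  rw [if_pos (Finset.mem_range.mpr (by omega))]

protected theorem mul_one' (A : HMat) : A * 1 = A := by
  apply ext
  intro j k
  apply PowerSeries.ext
  intro K
  rw [coeff_mul_entry _ _ j k K (j + K + k + 1) (by omega)]
  simp only [entry_one, mul_ite, mul_one, mul_zero, Finset.sum_ite_eq']
  rw [if_pos (Finset.mem_range.mpr (by omega))]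

theorem coeff_mul_congr {s t : HSer} (r : HSer) {K : ℕ}
    (h : ∀ q ≤ K, PowerSeries.coeff q s = PowerSeries.coeff q t) :
    PowerSeries.coeff K (s * r) = PowerSeries.coeff K (t * r) := by
  rw [PowerSeries.coeff_mul, PowerSeries.coeff_mul]
  refine Finset.sum_congr rfl fun pq hpq => ?_
  rw [h _ (by have := Finset.HasAntidiagonal.mem_antidiagonal.mp hpq; omega)]

protected theorem mul_assoc' (A B C : HMat) : A * B * C = A * (B * C) := by
  apply ext
  intro j k
  apply PowerSeries.ext
  intro K
  have h1 : PowerSeries.coeff K ((A * B * C).entry j k) = PowerSeries.coeff K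
      (∑ l ∈ Finset.range (j + 2 * K + 1), ∑ r ∈ Finset.range (j + 2 * K + 1),
        A.entry j r * B.entry r l * C.entry l k) := by
    rw [coeff_mul_entry _ _ j k K (j + 2 * K + 1) (by omega), map_sum, map_sum]
    refine Finset.sum_congr rfl fun l _ => ?_
    rw [← Finset.sum_mul]
    exact coeff_mul_congr _ fun q hq => coeff_mul_entry A B j l q _ (by omega)
  have h2 : PowerSeries.coeff K ((A * (B * C)).entry j k) = PowerSeries.coeff K
      (∑ r ∈ Finset.range (j + 2 * K + 1), ∑ l ∈ Finset.range (j + 2 * K + 1),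
        A.entry j r * B.entry r l * C.entry l k) := by
    rw [coeff_mul_entry _ _ j k K (j + 2 * K + 1) (by omega), map_sum, map_sum]
    refine Finset.sum_congr rfl fun r _ => ?_
    by_cases hr : j + K < r
    · rw [coeff_entry_mul _ _ hr]
      simp only [mul_assoc]
      rw [← Finset.mul_sum, coeff_entry_mul _ _ hr]
    · simp only [mul_assoc]
      rw [← Finset.mul_sum, mul_comm (A.entry j r), mul_comm (A.entry j r)]
      exact coeff_mul_congr _ fun q hq => coeff_mul_entry B C r k q _ (by omega)
  rw [h1, h2, Finset.sum_comm]

protected theorem smul_mul' (r : HSer) (A B : HMat) : (r • A) * B = r • (A * B) := by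
  apply ext
  intro j k
  apply PowerSeries.ext
  intro K
  rw [coeff_mul_entry _ _ j k K (j + K + 1) (by omega), entry_smul, mul_comm r]
  simp only [entry_smul, mul_assoc]
  rw [← Finset.mul_sum, mul_comm r]
  exact coeff_mul_congr _ fun q hq => (coeff_mul_entry A B j k q _ (by omega)).symm

protected theorem mul_smul' (r : HSer) (A B : HMat) : A * (r • B) = r • (A * B) := by
  apply ext
  intro j k
  apply PowerSeries.ext
  intro K
  rw [coeff_mul_entry _ _ j k K (j + K + 1) (by omega), entry_smul, mul_comm r]
  simp only [entry_smul, mul_left_comm _ r]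
  rw [← Finset.mul_sum, mul_comm r]
  exact coeff_mul_congr _ fun q hq => (coeff_mul_entry A B j k q _ (by omega)).symm

instance : Ring HMat :=
  { (inferInstance : AddCommGroup HMat), (inferInstance : Mul HMat),
    (inferInstance : One HMat) with
    left_distrib := HMat.mul_add'
    right_distrib := HMat.add_mul'
    zero_mul := HMat.zero_mul'
    mul_zero := HMat.mul_zero'
    mul_assoc := HMat.mul_assoc'
    one_mul := HMat.one_mul'
    mul_one := HMat.mul_one' }

instance : Algebra HSer HMat :=
  Algebra.ofModule HMat.smul_mul' (fun r A B => HMat.mul_smul' r A B)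

end HMat

/-- The standard matrix `a` of the destruction operator, with `√1, √2, √3, …` above the
diagonal. -/
def destrMat : Matrix ℕ ℕ HSer :=
  Matrix.of fun j l => if l = j + 1 then cst (Real.sqrt (j + 1) : ℝ) else 0

/-- The standard matrix `a†` of the creation operator, with `√1, √2, √3, …` below the
diagonal. -/
def creatMat : Matrix ℕ ℕ HSer :=
  Matrix.of fun j l => if j = l + 1 then cst (Real.sqrt (l + 1) : ℝ) else 0

/-- The matrix `a†` as an element of the ring of matrices. -/
def raiseMat : HMat := ⟨creatMat, fun j l => by
  by_cases h : j = l + 1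
  · simp [h]
  · simp [creatMat, h]⟩

/-- The matrix `-i ħ a` as an element of the ring of matrices. -/
def momMat : HMat := ⟨(cst (-Complex.I) * hbar) • destrMat, fun j l => by
  by_cases h : l = j + 1
  · subst h
    simp only [Matrix.smul_apply, smul_eq_mul, add_tsub_cancel_left, pow_one]
    exact Dvd.intro_left _ rfl |>.mul_right _
  · simp [destrMat, h]⟩

/-- The matrix `A` is the value of the non-commutative formal series `c` at `a†` (letter `0`)
and `-i ħ a` (letter `1`). -/
def IsMatSeries (c : NC) (A : HMat) : Prop :=
  ∀ j l : ℕ, HasFormalSum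
    (fun w : List (Fin 2) => c w * (w.map ![raiseMat, momMat]).prod.entry j l) (A.entry j l)

/-- The matrices that are formal power series in `a†`, `-i ħ a`, `ħ`. -/
def matSeriesSet : Set HMat := {A | ∃ c : NC, IsMatSeries c A}

/-- The matrix `F^(m, n) = (-i ħ a)^m (a†)^n`. -/
def Fmat (m n : ℕ) : HMat := momMat ^ m * raiseMat ^ n

/-- The number `m! n! / (s! (m-s)! (n-s)!)`, for `s ≤ min m n`. -/
def multi (m n s : ℕ) : ℂ :=
  (m.factorial : ℂ) * (n.factorial : ℂ) /
    ((s.factorial : ℂ) * ((m - s).factorial : ℂ) * ((n - s).factorial : ℂ))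

end Moyal

end

open Moyal

noncomputable section

namespace Moyal

/-! Everything reduces to normal ordering, the map `ordered` sending `p^m x^n` to `p̂^m x̂^n`. By
`weylMap_eq` the generalized Weyl map is `ordered ∘ f(-ħ ∂²/∂x∂p)`, and the second factor is
invertible because `f_0 = 1`. It remains to show that `ordered` is bijective and to find the product
it carries to that of `Heis`.

Product. Let `nstar` be multiplication composed with `exp(iħ ∂_x ⊗ ∂_p)`. Left multiplication by
`p̂` and `x̂` acts on symbols as `p` and `x + iħ ∂_p`, which gives `ordered_mul`. On pairs of
functions the Moyal product, the ordering operators on the two factors and the inverse ordering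
operator on the product (rewritten by the Leibniz rule) are exponentials of commuting operators.
Their exponents add up, so conjugating the Moyal product by `exp(iy/2)` gives exactly `nstar`
(`diffOp_moyal_diffOp`). Since `α = f · exp(iy/2)`, the product `gstar` is `nstar` conjugated by `f`
(`gstar_eq`).

Bijectivity. Surjectivity is reordering: every series has a normally ordered symbol
(`ordered_symbol`). Injectivity is proved together with faithfulness of the matrices
(`eq_zero_of_heisMat_ordered_eq_zero`). If the matrix of `ordered B` vanishes, commutators with `x̂`
and `p̂` show that those of `∂_p B` and `∂_x B` vanish too, since `iħ` can be cancelled. The entry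
`(0, 0)` at order `ħ^0` reads off the constant term of each derivative, so `B` vanishes at `ħ = 0`;
dividing by `ħ` and repeating gives `B = 0`.

Convergence is governed by one weight: `1` for each letter or variable and `2` for `ħ`, which makes
`[x̂, p̂] = iħ` homogeneous. The resulting filtrations are separated and finite sums of words or
monomials are dense, so identities between continuous linear maps are checked on words or monomials
(the two `linear_ext`).

The special orderings amount to finding `f = α · exp(-iy/2)` and using that `x̂^n p̂^m` has symbol
`exp(iħ ∂²/∂x∂p) (p^m x^n)`. -/

/-! ### Orders in `ħ` of products and formal sums. -/

theorem coeff_mul_eq_zero_of_le (r : HSer) {s : HSer} {K : ℕ}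
    (h : ∀ q ≤ K, PowerSeries.coeff q s = 0) : PowerSeries.coeff K (r * s) = 0 := by
  rw [mul_comm]
  have := HMat.coeff_mul_congr (s := s) (t := 0) r (K := K) (by simpa using h)
  simpa using this

/-- A product of two series vanishes in order `K` as soon as the factors vanish in complementary
orders. -/
theorem coeff_mul_eq_zero_of_add {r s : HSer} {K : ℕ}
    (h : ∀ q t, q + t = K → PowerSeries.coeff q r = 0 ∨ PowerSeries.coeff t s = 0) :
    PowerSeries.coeff K (r * s) = 0 := by
  rw [PowerSeries.coeff_mul]
  refine Finset.sum_eq_zero fun x hx => ?_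
  rcases h x.1 x.2 (Finset.HasAntidiagonal.mem_antidiagonal.mp hx) with h | h <;> simp [h]

theorem HasFormalSum.unique {ι : Type} {t : ι → HSer} {s s' : HSer} (h : HasFormalSum t s)
    (h' : HasFormalSum t s') : s = s' :=
  PowerSeries.ext fun K => (h K).2.trans (h' K).2.symm

/-! ### Words and filtration of the free series -/

/-- The words of length less than `N`. -/
def wordsLT (N : ℕ) : Finset (List (Fin 2)) := (List.finite_length_lt (Fin 2) N).toFinset

theorem mem_wordsLT {N : ℕ} {w : List (Fin 2)} : w ∈ wordsLT N ↔ w.length < N := by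
  simp [wordsLT]

namespace NC

/-- A word as a series. -/
def word (w : List (Fin 2)) : NC := fun v => if v = w then 1 else 0

theorem word_apply (w v : List (Fin 2)) : word w v = if v = w then 1 else 0 := rfl

theorem word_nil : word [] = 1 := rfl

theorem word_singleton (a : Fin 2) : word [a] = letter a := rfl

theorem word_cons (a : Fin 2) (w : List (Fin 2)) : word (a :: w) = letter a * word w := by
  apply ext
  intro v
  cases v with
  | nil => simp [mul_nil, word_apply, letter]
  | cons b v =>
    rw [mul_cons]
    have h : left b (letter a) = if b = a then 1 else 0 := by
      apply ext
      intro u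
      by_cases hb : b = a <;> simp [left_apply, letter, hb, one_apply, zero_apply]
    rw [h]
    by_cases hb : b = a <;> simp [hb, word_apply, letter, zero_apply]

theorem word_append (w v : List (Fin 2)) : word (w ++ v) = word w * word v := by
  induction w with
  | nil => simp [word_nil]
  | cons a w ih => rw [List.cons_append, word_cons, ih, word_cons, mul_assoc]

theorem word_replicate (a : Fin 2) (n : ℕ) : word (List.replicate n a) = letter a ^ n := by
  induction n with
  | zero => simp [word_nil]
  | succ n ih => rw [List.replicate_succ, word_cons, ih, pow_succ']

theorem sum_apply {ι : Type} (s : Finset ι) (c : ι → NC) (w : List (Fin 2)) :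
    (∑ i ∈ s, c i) w = ∑ i ∈ s, c i w :=
  Finset.sum_apply w s c

theorem sub_apply (c d : NC) (w : List (Fin 2)) : (c - d) w = c w - d w := rfl

/-- The series all of whose terms have weight at least `N`, where the letters have weight `1` and
`ħ` has weight `2`. -/
def filtr (N : ℕ) : Submodule HSer NC where
  carrier := {c | ∀ w k, w.length + 2 * k < N → PowerSeries.coeff k (c w) = 0}
  add_mem' hc hd w k h := by rw [add_apply, map_add, hc w k h, hd w k h, add_zero]
  zero_mem' w k _ := by rw [zero_apply, map_zero]
  smul_mem' r c hc w k h :=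
    coeff_mul_eq_zero_of_le r fun q hq => hc w q (by omega)

/-- The part of a series made of the words of length less than `N`. -/
def trunc (N : ℕ) (c : NC) : NC := ∑ w ∈ wordsLT N, c w • word w

theorem trunc_apply (N : ℕ) (c : NC) (v : List (Fin 2)) :
    trunc N c v = if v.length < N then c v else 0 := by
  simp only [trunc, sum_apply, smul_apply, word_apply, mul_ite, mul_one, mul_zero]
  refine (Finset.sum_ite_eq (wordsLT N) v (fun w => c w)).trans ?_
  simp only [mem_wordsLT]

theorem sub_trunc_mem (N : ℕ) (c : NC) : c - trunc N c ∈ filtr N := by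
  intro w k h
  rw [sub_apply, trunc_apply, if_pos (by omega), sub_self, map_zero]

theorem filtr_mul {N : ℕ} {c : NC} (hc : c ∈ filtr N) (d : NC) : c * d ∈ filtr N := by
  intro w k h
  rw [mul_apply, map_sum]
  refine Finset.sum_eq_zero fun i hi => coeff_mul_eq_zero_of_add fun q t hqt => Or.inl ?_
  exact hc _ _ (by simp; omega)

theorem mul_filtr {N : ℕ} (c : NC) {d : NC} (hd : d ∈ filtr N) : c * d ∈ filtr N := by
  intro w k h
  rw [mul_apply, map_sum]
  refine Finset.sum_eq_zero fun i hi => coeff_mul_eq_zero_of_add fun q t hqt => Or.inr ?_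
  exact hd _ _ (by simp; omega)

/-- A linear map that is continuous for a separated filtration and vanishes on words is zero. -/
theorem linear_eq_zero {M : Type*} [AddCommGroup M] [Module HSer M] (G : ℕ → Submodule HSer M)
    (hG : ∀ x, (∀ N, x ∈ G N) → x = 0) (T : NC →ₗ[HSer] M) (hT : ∀ N, ∀ c ∈ filtr N, T c ∈ G N)
    (h : ∀ w, T (word w) = 0) (c : NC) : T c = 0 := by
  refine hG _ fun N => ?_
  have h1 : T (trunc N c) = 0 := by simp [trunc, h]
  have h2 := hT N _ (sub_trunc_mem N c)
  rwa [map_sub, h1, sub_zero] at h2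

theorem linear_ext {M : Type*} [AddCommGroup M] [Module HSer M] (G : ℕ → Submodule HSer M)
    (hG : ∀ x, (∀ N, x ∈ G N) → x = 0) {T U : NC →ₗ[HSer] M}
    (hT : ∀ N, ∀ c ∈ filtr N, T c ∈ G N) (hU : ∀ N, ∀ c ∈ filtr N, U c ∈ G N)
    (h : ∀ w, T (word w) = U (word w)) (c : NC) : T c = U c := by
  have := linear_eq_zero G hG (T - U) (fun N c hc => sub_mem (hT N c hc) (hU N c hc))
    (fun w => by simp [h]) c
  simpa [sub_eq_zero] using this

end NC

/-! ### Evaluation of a series, one coordinate at a time -/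

/-- The formal sum `∑ w, c w * v w`, for a family `v` such that the terms of `v w` have order in
`ħ` at least `(|w| - b) / 2`. -/
def seriesAt (b : ℕ) (v : List (Fin 2) → HSer) (c : NC) : HSer :=
  PowerSeries.mk fun K => PowerSeries.coeff K (∑ w ∈ wordsLT (b + 2 * K + 1), c w * v w)

section seriesAt

variable {b : ℕ} {v : List (Fin 2) → HSer}

theorem support_coeff_mul_subset
    (hv : ∀ w K, b + 2 * K < w.length → PowerSeries.coeff K (v w) = 0) (c : NC) (K N : ℕ)
    (hN : b + 2 * K < N) :
    (Function.support fun w => PowerSeries.coeff K (c w * v w)) ⊆ wordsLT N := by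
  intro w hw
  by_contra hn
  refine hw (coeff_mul_eq_zero_of_le _ fun q hq => hv w q ?_)
  have : ¬ w.length < N := fun h => hn (mem_wordsLT.2 h)
  omega

/-- Words longer than `b + 2 * K` are invisible at order `K`, so the cutoff may be enlarged freely.
This lets different orders and different series be compared over one finite set of words. -/
theorem coeff_seriesAt (hv : ∀ w K, b + 2 * K < w.length → PowerSeries.coeff K (v w) = 0)
    (c : NC) (K N : ℕ) (hN : b + 2 * K < N) :
    PowerSeries.coeff K (seriesAt b v c) = PowerSeries.coeff K (∑ w ∈ wordsLT N, c w * v w) := by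
  rw [seriesAt, PowerSeries.coeff_mk, map_sum, map_sum,
    ← finsum_eq_sum_of_support_subset _ (support_coeff_mul_subset hv c K _ (Nat.lt_succ_self _)),
    ← finsum_eq_sum_of_support_subset _ (support_coeff_mul_subset hv c K N hN)]

theorem hasFormalSum_seriesAt
    (hv : ∀ w K, b + 2 * K < w.length → PowerSeries.coeff K (v w) = 0) (c : NC) :
    HasFormalSum (fun w => c w * v w) (seriesAt b v c) := by
  intro K
  have h := support_coeff_mul_subset hv c K _ (Nat.lt_succ_self _)
  refine ⟨(Finset.finite_toSet _).subset h, ?_⟩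
  rw [coeff_seriesAt hv c K _ (Nat.lt_succ_self _), map_sum, finsum_eq_sum_of_support_subset _ h]

theorem seriesAt_add (c d : NC) : seriesAt b v (c + d) = seriesAt b v c + seriesAt b v d := by
  ext K
  simp [seriesAt, NC.add_apply, add_mul, Finset.sum_add_distrib]

theorem seriesAt_smul (hv : ∀ w K, b + 2 * K < w.length → PowerSeries.coeff K (v w) = 0)
    (r : HSer) (c : NC) : seriesAt b v (r • c) = r * seriesAt b v c := by
  ext K
  rw [seriesAt, PowerSeries.coeff_mk]
  simp only [NC.smul_apply, mul_assoc]
  rw [← Finset.mul_sum, mul_comm r, mul_comm r]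
  exact HMat.coeff_mul_congr _ fun q hq => (coeff_seriesAt hv c q _ (by omega)).symm

theorem seriesAt_word (hv : ∀ w K, b + 2 * K < w.length → PowerSeries.coeff K (v w) = 0)
    (w : List (Fin 2)) : seriesAt b v (NC.word w) = v w := by
  ext K
  rw [coeff_seriesAt hv _ K (b + 2 * K + w.length + 1) (by omega)]
  simp only [NC.word_apply, ite_mul, one_mul, zero_mul, Finset.sum_ite_eq']
  rw [if_pos (mem_wordsLT.2 (by omega))]

theorem coeff_seriesAt_of_mem_filtr
    (hv : ∀ w K, b + 2 * K < w.length → PowerSeries.coeff K (v w) = 0) {N : ℕ} {c : NC}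
    (hc : c ∈ NC.filtr N) {K : ℕ} (hK : b + 2 * K < N) :
    PowerSeries.coeff K (seriesAt b v c) = 0 := by
  rw [coeff_seriesAt hv c K _ (Nat.lt_succ_self _), map_sum]
  refine Finset.sum_eq_zero fun w _ => coeff_mul_eq_zero_of_add fun q t hqt => ?_
  -- Either the word is too long for `v w` to reach order `t`, or `|w| + 2q ≤ b + 2t + 2q = b + 2K <
  -- N` and the coefficient of `c` vanishes.
  by_cases h : b + 2 * t < w.length
  · exact Or.inr (hv w t h)
  · exact Or.inl (hc w q (by omega))

end seriesAt

/-! ### The algebra of matrices -/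

namespace HMat

theorem entry_sub (A B : HMat) (j l : ℕ) : (A - B).entry j l = A.entry j l - B.entry j l := rfl

/-- An entry of a matrix, as a linear function of the matrix. -/
def entryLin (j l : ℕ) : HMat →ₗ[HSer] HSer where
  toFun A := A.entry j l
  map_add' _ _ := rfl
  map_smul' _ _ := rfl

/-- Each row of `raiseMat` and of `momMat` has at most one nonzero entry, so products with them on
the left need no infinite sum. -/
theorem entry_mul_of_row (A B : HMat) (j k l₀ : ℕ) (h : ∀ l, l ≠ l₀ → A.entry j l = 0) :
    (A * B).entry j k = A.entry j l₀ * B.entry l₀ k := by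
  apply PowerSeries.ext
  intro K
  rw [coeff_mul_entry A B j k K (j + K + l₀ + 1) (by omega)]
  rw [Finset.sum_eq_single l₀]
  · intro l _ hl
    rw [h l hl, zero_mul]
  · intro hl
    exact absurd (Finset.mem_range.2 (by omega)) hl

/-- The matrices whose entries in row `j` have order in `ħ` at least `(N - j) / 2`. -/
def filtr (N : ℕ) : Submodule HSer HMat where
  carrier := {A | ∀ j l K, j + 2 * K < N → PowerSeries.coeff K (A.entry j l) = 0}
  add_mem' hA hB j l K h := by rw [entry_add, map_add, hA j l K h, hB j l K h, add_zero]
  zero_mem' j l K _ := by rw [entry_zero, map_zero]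
  smul_mem' r A hA j l K h :=
    coeff_mul_eq_zero_of_le r fun q hq => hA j l q (by omega)

theorem eq_zero_of_mem_filtr (A : HMat) (h : ∀ N, A ∈ filtr N) : A = 0 := by
  apply ext
  intro j l
  apply PowerSeries.ext
  intro K
  rw [entry_zero, map_zero]
  exact h (j + 2 * K + 1) j l K (Nat.lt_succ_self _)

theorem filtr_mul {N : ℕ} {A : HMat} (hA : A ∈ filtr N) (B : HMat) : A * B ∈ filtr N := by
  intro j k K h
  rw [coeff_mul_entry A B j k K _ (Nat.lt_succ_self _), map_sum]
  refine Finset.sum_eq_zero fun l _ => coeff_mul_eq_zero_of_add fun q t hqt => Or.inl ?_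
  exact hA j l q (by omega)

theorem mul_filtr {N : ℕ} (A : HMat) {B : HMat} (hB : B ∈ filtr N) : A * B ∈ filtr N := by
  intro j k K h
  rw [coeff_mul_entry A B j k K _ (Nat.lt_succ_self _), map_sum]
  refine Finset.sum_eq_zero fun l _ => coeff_mul_eq_zero_of_add fun q t hqt => ?_
  -- Here bandedness matters: `A` reaches row `l` at order `q` only if `l ≤ j + q`, and then `l + 2t
  -- ≤ j + 2K < N`.
  by_cases hl : j + q < l
  · exact Or.inl (A.coeff_entry hl)
  · exact Or.inr (hB l k t (by omega))

end HMat

theorem raiseMat_entry (j l : ℕ) :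
    raiseMat.entry j l = if j = l + 1 then cst (Real.sqrt (l + 1) : ℝ) else 0 := rfl

theorem momMat_entry (j l : ℕ) : momMat.entry j l =
    (cst (-Complex.I) * hbar) * if l = j + 1 then cst (Real.sqrt (j + 1) : ℝ) else 0 := rfl

theorem raiseMat_mul_entry (A : HMat) (j k : ℕ) :
    (raiseMat * A).entry j k = cst (Real.sqrt j : ℝ) * A.entry (j - 1) k := by
  rw [HMat.entry_mul_of_row _ _ j k (j - 1), raiseMat_entry]
  -- In row `0` the truncated index `j - 1` is `0`, but the factor `√0` kills the term.
  · rcases j with _ | j <;> simp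
  · intro l hl
    rw [raiseMat_entry, if_neg (by omega)]

theorem momMat_mul_entry (A : HMat) (j k : ℕ) : (momMat * A).entry j k =
    (cst (-Complex.I) * hbar) * (cst (Real.sqrt (j + 1) : ℝ) * A.entry (j + 1) k) := by
  rw [HMat.entry_mul_of_row _ _ j k (j + 1), momMat_entry, if_pos rfl, mul_assoc]
  intro l hl
  rw [momMat_entry, if_neg hl, mul_zero]

theorem cst_sqrt_mul_self (j : ℕ) :
    cst (Real.sqrt j : ℝ) * cst (Real.sqrt j : ℝ) = (j : HSer) := by
  rw [← map_mul, ← Complex.ofReal_mul, Real.mul_self_sqrt (Nat.cast_nonneg j)]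
  simp

/-- Both products are diagonal: row `j` has `-iħ j` in the first and `-iħ (j + 1)` in the second. -/
theorem raiseMat_momMat_commutator :
    raiseMat * momMat - momMat * raiseMat = (cst Complex.I * hbar) • (1 : HMat) := by
  apply HMat.ext
  intro j k
  -- The inserted unit lets the row formulas for left multiplication apply twice.
  have h : raiseMat * momMat - momMat * raiseMat =
      raiseMat * (momMat * 1) - momMat * (raiseMat * 1) := by rw [mul_one, mul_one]
  rw [h, HMat.entry_sub, HMat.entry_smul, raiseMat_mul_entry, momMat_mul_entry, momMat_mul_entry,
    raiseMat_mul_entry]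
  have h1 := cst_sqrt_mul_self (j + 1)
  push_cast at h1
  rcases j with _ | j
  · rw [Nat.add_sub_cancel]
    simp only [map_neg, Nat.cast_zero, Real.sqrt_zero, Complex.ofReal_zero, map_zero,
      zero_mul, zero_add, Nat.cast_one] at h1 ⊢
    linear_combination (cst Complex.I * hbar * (1 : HMat).entry 0 k) * h1
  · have h2 := cst_sqrt_mul_self (j + 1)
    push_cast at h1 h2 ⊢
    simp only [map_neg]
    linear_combination (cst Complex.I * hbar * (1 : HMat).entry (j + 1) k) * (h1 - h2)

/-- The value of a word at the matrices `a†` and `-i ħ a`. -/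
def wordMat (w : List (Fin 2)) : HMat := (w.map ![raiseMat, momMat]).prod

theorem wordMat_nil : wordMat [] = 1 := rfl

theorem wordMat_cons (a : Fin 2) (w : List (Fin 2)) :
    wordMat (a :: w) = ![raiseMat, momMat] a * wordMat w := by
  simp [wordMat]

theorem wordMat_append (w v : List (Fin 2)) : wordMat (w ++ v) = wordMat w * wordMat v := by
  simp [wordMat]

/-- Each letter adds one to the weight: `a†` shifts row `j - 1` to row `j`, while `-iħa` shifts row
`j + 1` to row `j` and pays with a factor `ħ` of weight `2`. This makes the substitution of the
matrices into a series a formal sum. -/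
theorem wordMat_mem_filtr (w : List (Fin 2)) : wordMat w ∈ HMat.filtr w.length := by
  induction w with
  | nil => exact fun _ _ _ h => absurd h (Nat.not_lt_zero _)
  | cons a w ih =>
    intro j l K h
    rw [List.length_cons] at h
    rw [wordMat_cons]
    fin_cases a
    · change PowerSeries.coeff K ((raiseMat * wordMat w).entry j l) = 0
      rw [raiseMat_mul_entry]
      rcases j with _ | j
      · simp
      · exact coeff_mul_eq_zero_of_le _ fun q hq => ih _ _ _ (by omega)
    · change PowerSeries.coeff K ((momMat * wordMat w).entry j l) = 0
      rw [momMat_mul_entry, mul_assoc, mul_left_comm]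
      rcases K with _ | K
      · simp
      · rw [PowerSeries.coeff_succ_X_mul, ← mul_assoc]
        exact coeff_mul_eq_zero_of_le _ fun q hq => ih _ _ _ (by omega)

theorem coeff_wordMat_entry (j l : ℕ) (w : List (Fin 2)) (K : ℕ) (h : j + 2 * K < w.length) :
    PowerSeries.coeff K ((wordMat w).entry j l) = 0 :=
  wordMat_mem_filtr w j l K h

/-- The value of a series at the matrices `a†` and `-i ħ a`, as a linear map. -/
def matEvalLin : NC →ₗ[HSer] HMat where
  toFun c := ⟨Matrix.of fun j l => seriesAt j (fun w => (wordMat w).entry j l) c, fun j l => by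
    rw [PowerSeries.X_pow_dvd_iff]
    intro K hK
    change PowerSeries.coeff K (seriesAt j (fun w => (wordMat w).entry j l) c) = 0
    rw [seriesAt, PowerSeries.coeff_mk, map_sum]
    -- Bandedness passes to the sum because every `wordMat w` is banded.
    exact Finset.sum_eq_zero fun w _ => coeff_mul_eq_zero_of_le _ fun q hq =>
      (wordMat w).coeff_entry (by omega)⟩
  map_add' c d := HMat.ext fun j l => seriesAt_add c d
  map_smul' r c := HMat.ext fun j l => seriesAt_smul (coeff_wordMat_entry j l) r c

theorem matEvalLin_entry (c : NC) (j l : ℕ) :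
    (matEvalLin c).entry j l = seriesAt j (fun w => (wordMat w).entry j l) c := rfl

theorem matEvalLin_word (w : List (Fin 2)) : matEvalLin (NC.word w) = wordMat w :=
  HMat.ext fun j l => seriesAt_word (coeff_wordMat_entry j l) w

theorem matEvalLin_mem_filtr {N : ℕ} {c : NC} (hc : c ∈ NC.filtr N) :
    matEvalLin c ∈ HMat.filtr N := fun j l _ h =>
  coeff_seriesAt_of_mem_filtr (coeff_wordMat_entry j l) hc h

/-- Both sides are linear and continuous in each argument, so words suffice, and there concatenation
is the product. -/
theorem matEvalLin_mul (c d : NC) : matEvalLin (c * d) = matEvalLin c * matEvalLin d := by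
  refine NC.linear_ext HMat.filtr HMat.eq_zero_of_mem_filtr
    (T := matEvalLin ∘ₗ LinearMap.mulRight HSer d)
    (U := LinearMap.mulRight HSer (matEvalLin d) ∘ₗ matEvalLin)
    (fun N c hc => matEvalLin_mem_filtr (NC.filtr_mul hc d))
    (fun N c hc => HMat.filtr_mul (matEvalLin_mem_filtr hc) _) (fun w => ?_) c
  refine NC.linear_ext HMat.filtr HMat.eq_zero_of_mem_filtr
    (T := matEvalLin ∘ₗ LinearMap.mulLeft HSer (NC.word w))
    (U := LinearMap.mulLeft HSer (matEvalLin (NC.word w)) ∘ₗ matEvalLin)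
    (fun N c hc => matEvalLin_mem_filtr (NC.mul_filtr _ hc))
    (fun N c hc => HMat.mul_filtr _ (matEvalLin_mem_filtr hc)) (fun v => ?_) d
  change matEvalLin (NC.word w * NC.word v) = matEvalLin (NC.word w) * matEvalLin (NC.word v)
  rw [← NC.word_append, matEvalLin_word, matEvalLin_word, matEvalLin_word, wordMat_append]

/-- The value of a series at the matrices `a†` and `-i ħ a`. -/
def matEval : NC →ₐ[HSer] HMat :=
  AlgHom.ofLinearMap matEvalLin (by rw [← NC.word_nil, matEvalLin_word, wordMat_nil])
    matEvalLin_mul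

theorem matEval_apply (c : NC) : matEval c = matEvalLin c := rfl

theorem matEval_word (w : List (Fin 2)) : matEval (NC.word w) = wordMat w := matEvalLin_word w

theorem matEval_mem_filtr {N : ℕ} {c : NC} (hc : c ∈ NC.filtr N) : matEval c ∈ HMat.filtr N :=
  matEvalLin_mem_filtr hc

theorem matEval_letter_zero : matEval (NC.letter 0) = raiseMat := by
  rw [← NC.word_singleton, matEval_word, wordMat_cons, wordMat_nil, mul_one]; rfl

theorem matEval_letter_one : matEval (NC.letter 1) = momMat := by
  rw [← NC.word_singleton, matEval_word, wordMat_cons, wordMat_nil, mul_one]; rfl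

theorem isMatSeries_matEval (c : NC) : IsMatSeries c (matEval c) := fun j l =>
  hasFormalSum_seriesAt (coeff_wordMat_entry j l) c

theorem IsMatSeries.unique {c : NC} {A B : HMat} (hA : IsMatSeries c A) (hB : IsMatSeries c B) :
    A = B :=
  HMat.ext fun j l => (hA j l).unique (hB j l)

/-- A linear functional of matrices commutes with the evaluation of formal series if it sees only
finitely many rows in each order of `ħ`. -/
theorem hasFormalSum_matEval (b : ℕ) (Λ : HMat →ₗ[HSer] HSer)
    (hΛ : ∀ N, ∀ A ∈ HMat.filtr N, ∀ K, b + 2 * K < N → PowerSeries.coeff K (Λ A) = 0) (c : NC) :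
    HasFormalSum (fun w => c w * Λ (wordMat w)) (Λ (matEval c)) := by
  have hv : ∀ w K, b + 2 * K < w.length → PowerSeries.coeff K (Λ (wordMat w)) = 0 :=
    fun w K h => hΛ _ _ (wordMat_mem_filtr w) K h
  have h : Λ (matEval c) = seriesAt b (fun w => Λ (wordMat w)) c := by
    ext K
    rw [coeff_seriesAt hv c K _ (Nat.lt_succ_self _)]
    -- What the truncation discards has weight at least `b + 2K + 1`, so `Λ` does not see it at
    -- order `K`.
    have h1 := hΛ _ _ (matEval_mem_filtr (NC.sub_trunc_mem (b + 2 * K + 1) c)) K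
      (Nat.lt_succ_self _)
    rw [map_sub, map_sub, map_sub, sub_eq_zero] at h1
    rw [h1, NC.trunc, map_sum, map_sum]
    simp [matEval_word]
  rw [h]
  exact hasFormalSum_seriesAt hv c

/-! ### The action of matrices on state vectors -/

/-- The matrix with a given column `0` and all other columns `0`. -/
def colMat : Fock →ₗ[HSer] HMat where
  toFun ψ := ⟨Matrix.of fun j k => if k = 0 then ψ j else 0, fun j k => by
    by_cases h : k = 0 <;> simp [h]⟩
  map_add' ψ χ := HMat.ext fun j k => by
    change (if k = 0 then ψ j + χ j else 0) = (if k = 0 then ψ j else 0) + if k = 0 then χ j else 0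
    split_ifs <;> simp
  map_smul' r ψ := HMat.ext fun j k => by
    change (if k = 0 then r * ψ j else 0) = r * if k = 0 then ψ j else 0
    split_ifs <;> simp

theorem colMat_entry (ψ : Fock) (j k : ℕ) :
    (colMat ψ).entry j k = if k = 0 then ψ j else 0 := rfl

/-- A matrix times a column matrix is again a column matrix. With states encoded as column `0`,
which satisfies the band condition trivially, multiplicativity of the action becomes associativity
in `HMat`. -/
theorem mul_colMat_entry (A : HMat) (ψ : Fock) (j : ℕ) {k : ℕ} (hk : k ≠ 0) :
    (A * colMat ψ).entry j k = 0 := by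
  apply PowerSeries.ext
  intro K
  rw [HMat.coeff_mul_entry _ _ j k K _ (Nat.lt_succ_self _)]
  simp [colMat_entry, hk]

/-- The operator with a given matrix. -/
def matAct : HMat →ₐ[HSer] Module.End HSer Fock :=
  AlgHom.ofLinearMap
    { toFun := fun A =>
        { toFun := fun ψ j => (A * colMat ψ).entry j 0
          map_add' := fun ψ χ => by funext j; rw [map_add, mul_add]; rfl
          map_smul' := fun r ψ => by funext j; rw [map_smul, mul_smul_comm]; rfl }
      map_add' := fun A B => by ext ψ j : 2; change ((A + B) * _).entry _ _ = _; rw [add_mul]; rfl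
      map_smul' := fun r A => by
        ext ψ j : 2; change ((r • A) * _).entry _ _ = _; rw [smul_mul_assoc]; rfl }
    (by ext ψ j : 2; change (1 * colMat ψ).entry j 0 = ψ j; rw [one_mul]; rfl)
    (fun A B => by
      ext ψ j : 2
      change (A * B * colMat ψ).entry j 0 =
        (A * colMat fun i => (B * colMat ψ).entry i 0).entry j 0
      have h : (colMat fun i => (B * colMat ψ).entry i 0) = B * colMat ψ := by
        apply HMat.ext
        intro i k
        rw [colMat_entry]
        split_ifs with hk
        · rw [hk]
        · rw [mul_colMat_entry _ _ _ hk]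
      rw [h, mul_assoc])

theorem matAct_apply (A : HMat) (ψ : Fock) (j : ℕ) :
    matAct A ψ j = (A * colMat ψ).entry j 0 := rfl

/-- The columns are recovered from the values on the basis states `Pi.single l 1`. -/
theorem matAct_injective : Function.Injective matAct := by
  intro A B h
  apply HMat.ext
  intro j l
  have key : ∀ C : HMat, matAct C (Pi.single l 1) j = C.entry j l := by
    intro C
    rw [matAct_apply]
    apply PowerSeries.ext
    intro K
    rw [HMat.coeff_mul_entry _ _ j 0 K (j + K + l + 1) (by omega)]
    simp only [colMat_entry, Pi.single_apply, if_true, mul_ite, mul_one, mul_zero,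
      Finset.sum_ite_eq']
    rw [if_pos (Finset.mem_range.2 (by omega))]
  rw [← key, ← key, h]

theorem matAct_raiseMat : matAct raiseMat = creat := by
  ext ψ j : 2
  rw [matAct_apply, raiseMat_mul_entry]
  rfl

theorem matAct_momMat : matAct momMat = momOp := by
  ext ψ j : 2
  rw [matAct_apply, momMat_mul_entry]
  rfl

theorem matAct_wordMat (w : List (Fin 2)) :
    matAct (wordMat w) = (w.map ![creat, momOp]).prod := by
  rw [wordMat, map_list_prod, List.map_map]
  congr 2
  funext a
  fin_cases a
  · exact matAct_raiseMat
  · exact matAct_momMat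

theorem isOpSeries_matAct (c : NC) : IsOpSeries c (matAct (matEval c)) := by
  intro ψ j
  have h := hasFormalSum_matEval j (HMat.entryLin j 0 ∘ₗ LinearMap.mulRight HSer (colMat ψ))
    (fun N A hA K hK => HMat.filtr_mul hA (colMat ψ) j 0 K hK) c
  simp only [← matAct_wordMat]
  exact h

theorem IsOpSeries.unique {c : NC} {T U : Module.End HSer Fock} (hT : IsOpSeries c T)
    (hU : IsOpSeries c U) : T = U := by
  ext ψ j : 2
  exact (hT ψ j).unique (hU ψ j)

theorem cst_sum {ι : Type} (s : Finset ι) (z : ι → ℂ) :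
    cst (∑ i ∈ s, z i) = ∑ i ∈ s, cst (z i) :=
  map_sum (PowerSeries.C : ℂ →+* HSer) z s

theorem cst_mul (y z : ℂ) : cst (y * z) = cst y * cst z := map_mul _ y z

theorem cst_pow (z : ℂ) (n : ℕ) : cst (z ^ n) = cst z ^ n := map_pow _ z n

/-! ### Formal sums in phase space -/

/-- The coefficients of the formal sum `∑ r, ħ ^ r * T r`. -/
theorem coeff_hbarSum (T : ℕ → Phase) (e : Fin 2 →₀ ℕ) (K : ℕ) :
    PowerSeries.coeff K (MvPowerSeries.coeff e (hbarSum T)) =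
      ∑ r ∈ Finset.range (K + 1), PowerSeries.coeff (K - r) (MvPowerSeries.coeff e (T r)) := by
  rw [show MvPowerSeries.coeff e (hbarSum T) = PowerSeries.mk fun K =>
    ∑ r ∈ Finset.range (K + 1), PowerSeries.coeff (K - r) (MvPowerSeries.coeff e (T r)) from rfl,
    PowerSeries.coeff_mk]

theorem Phase.ext {A B : Phase} (h : ∀ e K, PowerSeries.coeff K (MvPowerSeries.coeff e A) =
    PowerSeries.coeff K (MvPowerSeries.coeff e B)) : A = B :=
  MvPowerSeries.ext fun e => PowerSeries.ext fun K => h e K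

/-- The `ħ`-adic topology on phase space series is separated. -/
theorem Phase.eq_of_hbar_pow {A B : Phase} (h : ∀ N, ∃ D, A = B + (hbar ^ N : HSer) • D) :
    A = B := by
  refine Phase.ext fun e K => ?_
  obtain ⟨D, hD⟩ := h (K + 1)
  rw [hD, map_add, map_add, MvPowerSeries.coeff_smul, PowerSeries.coeff_X_pow_mul',
    if_neg (by omega), add_zero]

theorem hbarSum_eq_sum_add (T : ℕ → Phase) (N : ℕ) :
    hbarSum T = ∑ r ∈ Finset.range N, (hbar ^ r : HSer) • T r +
      (hbar ^ N : HSer) • hbarSum fun r => T (r + N) := by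
  refine Phase.ext fun e K => ?_
  rw [map_add, map_add, map_sum, map_sum, MvPowerSeries.coeff_smul, PowerSeries.coeff_X_pow_mul']
  simp only [MvPowerSeries.coeff_smul, PowerSeries.coeff_X_pow_mul', coeff_hbarSum]
  split_ifs with h
  · rw [show K + 1 = N + (K - N + 1) by omega, Finset.sum_range_add]
    congr 1
    · refine Finset.sum_congr rfl fun r hr => ?_
      rw [if_pos (by have := Finset.mem_range.1 hr; omega)]
    · refine Finset.sum_congr rfl fun r hr => ?_
      rw [show N + r = r + N by omega, show K - (r + N) = K - N - r by omega]
  · rw [add_zero, ← Finset.sum_filter]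
    refine Finset.sum_congr ?_ fun _ _ => rfl
    ext r
    simp
    omega

/-- No continuity of `Λ` is needed: the tail of the sum is `ħ^N` times a series, and linearity over
`ℂ[[ħ]]` keeps its image divisible by `ħ^N` for every `N`. -/
theorem map_hbarSum (Λ : Phase →ₗ[HSer] Phase) (T : ℕ → Phase) :
    Λ (hbarSum T) = hbarSum fun r => Λ (T r) := by
  refine Phase.eq_of_hbar_pow fun N => ⟨Λ (hbarSum fun r => T (r + N)) -
    hbarSum fun r => Λ (T (r + N)), ?_⟩
  rw [hbarSum_eq_sum_add T N, hbarSum_eq_sum_add (fun r => Λ (T r)) N, smul_sub, map_add, map_sum,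
    map_smul]
  simp only [map_smul]
  abel

theorem hbarSum_add (T U : ℕ → Phase) :
    hbarSum (fun r => T r + U r) = hbarSum T + hbarSum U := by
  refine Phase.ext fun e K => ?_
  simp [coeff_hbarSum, Finset.sum_add_distrib]

theorem hbarSum_smul (r : HSer) (T : ℕ → Phase) :
    hbarSum (fun s => r • T s) = r • hbarSum T :=
  (map_hbarSum
    { toFun := fun A => r • A
      map_add' := smul_add r
      map_smul' := fun s A => smul_comm r s A } T).symm

theorem hbarSum_eq_sum (T : ℕ → Phase) (N : ℕ) (h : ∀ r, N ≤ r → T r = 0) :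
    hbarSum T = ∑ r ∈ Finset.range N, (hbar ^ r : HSer) • T r := by
  have h0 : (hbarSum fun r => T (r + N)) = 0 := by
    refine Phase.ext fun e K => ?_
    simp [coeff_hbarSum, h]
  rw [hbarSum_eq_sum_add T N, h0, smul_zero, add_zero]

/-- The term `T k l` carries `ħ^(k+l)`, so at each order the double sum runs over a finite triangle
and can be regrouped along its diagonals. -/
theorem hbarSum_hbarSum (T : ℕ → ℕ → Phase) :
    hbarSum (fun r => hbarSum (T r)) =
      hbarSum fun n => ∑ k ∈ Finset.range (n + 1), T k (n - k) := by
  refine Phase.ext fun e K => ?_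
  simp only [coeff_hbarSum, map_sum]
  have h := Finset.sum_range_diag_flip (K + 1)
    (fun i j => PowerSeries.coeff (K - (i + j)) (MvPowerSeries.coeff e (T i j)))
  refine Eq.trans (Finset.sum_congr rfl fun r hr => ?_)
    (h.symm.trans (Finset.sum_congr rfl fun n hn => Finset.sum_congr rfl fun k hk => ?_))
  · have := Finset.mem_range.1 hr
    rw [show K + 1 - r = K - r + 1 by omega]
    exact Finset.sum_congr rfl fun s _ => by rw [Nat.sub_sub]
  · have := Finset.mem_range.1 hk
    rw [show k + (n - k) = n by omega]

/-! ### Operators `φ(-ħ ∂²/∂x∂p)` -/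

/-- `∂/∂x` as a linear map. -/
def dxLin : Module.End HSer Phase := (MvPowerSeries.pderiv HSer (0 : Fin 2)).toLinearMap

/-- `∂/∂p` as a linear map. -/
def dpLin : Module.End HSer Phase := (MvPowerSeries.pderiv HSer (1 : Fin 2)).toLinearMap

theorem dxLin_apply (A : Phase) : dxLin A = dx A := rfl

theorem dpLin_apply (A : Phase) : dpLin A = dp A := rfl

theorem commute_dxLin_dpLin : Commute dxLin dpLin := by
  refine LinearMap.ext fun A => MvPowerSeries.ext fun e => ?_
  simp only [Module.End.mul_apply, dxLin_apply, dpLin_apply, MvPowerSeries.coeff_pderiv]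
  simp [add_right_comm, mul_right_comm]

/-- `∂²/∂x∂p` as a linear map. -/
def dxdp : Module.End HSer Phase := dxLin * dpLin

theorem diffOp_eq (φ : PowerSeries ℂ) (A : Phase) : diffOp φ A =
    hbarSum fun s => (cst ((-1) ^ s * PowerSeries.coeff s φ) • dxdp ^ s) A := by
  rw [diffOp]
  congr 1
  funext s
  rw [LinearMap.smul_apply, Module.End.pow_apply]
  rfl

/-- The operator `φ(-ħ ∂²/∂x∂p)` as a linear map. -/
def diffOpLin (φ : PowerSeries ℂ) : Module.End HSer Phase where
  toFun := diffOp φ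
  map_add' A B := by simp only [diffOp_eq, map_add, hbarSum_add]
  map_smul' r A := by simp only [diffOp_eq, map_smul, hbarSum_smul]; rfl

/-- Substituting one operator for `y` respects Cauchy products; this yields all the inverses used
below. -/
theorem diffOp_diffOp (φ ψ : PowerSeries ℂ) (A : Phase) :
    diffOp φ (diffOp ψ A) = diffOp (φ * ψ) A := by
  rw [diffOp_eq ψ, diffOp_eq φ, diffOp_eq (φ * ψ)]
  simp only [map_hbarSum]
  rw [hbarSum_hbarSum]
  congr 1
  funext n
  rw [PowerSeries.coeff_mul, Finset.Nat.sum_antidiagonal_eq_sum_range_succ_mk, Finset.mul_sum]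
  rw [cst_sum, Finset.sum_smul, LinearMap.sum_apply]
  refine Finset.sum_congr rfl fun k hk => ?_
  have hk : k + (n - k) = n := by have := Finset.mem_range.1 hk; omega
  rw [← Module.End.mul_apply, smul_mul_smul_comm, ← map_mul, ← pow_add, hk]
  congr 3
  rw [mul_mul_mul_comm, ← pow_add, hk]

theorem diffOp_one (A : Phase) : diffOp 1 A = A := by
  rw [diffOp_eq, hbarSum_eq_sum _ 1]
  · simp
  · intro r hr
    simp [PowerSeries.coeff_one, show r ≠ 0 by omega]

theorem diffOp_mul_cancel {φ ψ : PowerSeries ℂ} (h : φ * ψ = 1) (A : Phase) :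
    diffOp φ (diffOp ψ A) = A := by
  rw [diffOp_diffOp, h, diffOp_one]

theorem constantCoeff_expSer (c : ℂ) : PowerSeries.constantCoeff (expSer c) = 1 := by
  simp [expSer, ← PowerSeries.coeff_zero_eq_constantCoeff, PowerSeries.coeff_rescale]

theorem coeff_expSer (c : ℂ) (n : ℕ) :
    PowerSeries.coeff n (expSer c) = c ^ n / (n.factorial : ℂ) := by
  simp [expSer, PowerSeries.coeff_rescale, PowerSeries.coeff_exp, div_eq_mul_inv]

theorem expSer_mul (a b : ℂ) : expSer a * expSer b = expSer (a + b) :=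
  PowerSeries.exp_mul_exp_eq_exp_add a b

theorem expSer_zero : expSer 0 = 1 := by
  ext n
  rw [coeff_expSer, PowerSeries.coeff_one]
  split_ifs with h <;> simp [h]

theorem expSer_inv (a : ℂ) : (expSer a)⁻¹ = expSer (-a) := by
  rw [PowerSeries.inv_eq_iff_mul_eq_one (by simp [constantCoeff_expSer]), expSer_mul,
    neg_add_cancel, expSer_zero]

theorem constantCoeff_alpha (f : PowerSeries ℂ) :
    PowerSeries.constantCoeff (alpha f) = PowerSeries.constantCoeff f := by
  rw [alpha, map_mul, constantCoeff_expSer, mul_one]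

/-! ### Exponentials of commuting endomorphisms -/

/-- The series `∑ n, Xⁿ / n! tⁿ`. -/
def expEnd {E : Type*} [Semiring E] [Algebra HSer E] (X : E) : PowerSeries E :=
  PowerSeries.mk fun n => cst (1 / (n.factorial : ℂ)) • X ^ n

theorem coeff_expEnd {E : Type*} [Semiring E] [Algebra HSer E] (X : E) (n : ℕ) :
    PowerSeries.coeff n (expEnd X) = cst (1 / (n.factorial : ℂ)) • X ^ n :=
  PowerSeries.coeff_mk _ _

/-- This is the binomial theorem for commuting elements. The series variable only marks the order;
`hbarSum` later replaces it by `ħ`. -/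
theorem expEnd_mul {E : Type*} [Semiring E] [Algebra HSer E] {X Y : E} (h : Commute X Y) :
    expEnd X * expEnd Y = expEnd (X + Y) := by
  ext n
  rw [PowerSeries.coeff_mul, coeff_expEnd, h.add_pow', Finset.smul_sum]
  refine Finset.sum_congr rfl fun x hx => ?_
  have hx : x.1 + x.2 = n := by simpa using hx
  rw [coeff_expEnd, coeff_expEnd, smul_mul_smul_comm, ← map_mul, ← Nat.cast_smul_eq_nsmul HSer,
    smul_smul]
  congr 1
  rw [← map_natCast (PowerSeries.C : ℂ →+* HSer), ← map_mul]
  congr 1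
  subst hx
  rw [Nat.cast_add_choose]
  have h1 : ((x.1 + x.2).factorial : ℂ) ≠ 0 := Nat.cast_ne_zero.2 (Nat.factorial_ne_zero _)
  have h2 : (x.1.factorial : ℂ) ≠ 0 := Nat.cast_ne_zero.2 (Nat.factorial_ne_zero _)
  have h3 : (x.2.factorial : ℂ) ≠ 0 := Nat.cast_ne_zero.2 (Nat.factorial_ne_zero _)
  field_simp

theorem diffOp_expSer (c : ℂ) (A : Phase) : diffOp (expSer c) A =
    hbarSum fun s => PowerSeries.coeff s (expEnd (cst (-c) • dxdp)) A := by
  rw [diffOp_eq]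
  congr 1
  funext s
  rw [coeff_expEnd, smul_pow, smul_smul, coeff_expSer, ← map_pow, ← map_mul]
  congr 3
  rw [← neg_one_mul c, mul_pow]
  ring

/-! ### The product of normally ordered symbols -/

open TensorProduct in
/-- Pairs of phase space series. -/
abbrev PhasePair : Type := Phase ⊗[HSer] Phase

/-- The product of phase space series as a linear map on pairs. -/
def mulPair : PhasePair →ₗ[HSer] Phase := LinearMap.mul' HSer Phase

/-- An operator acting on the first factor. -/
def onFst : Module.End HSer Phase →ₐ[HSer] Module.End HSer PhasePair :=
  Module.End.rTensorAlgHom HSer Phase Phase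

/-- An operator acting on the second factor. -/
def onSnd : Module.End HSer Phase →ₐ[HSer] Module.End HSer PhasePair :=
  Module.End.lTensorAlgHom HSer Phase Phase

open TensorProduct in
theorem onFst_tmul (X : Module.End HSer Phase) (A B : Phase) :
    onFst X (A ⊗ₜ[HSer] B) = X A ⊗ₜ[HSer] B := LinearMap.rTensor_tmul _ _ _ _

open TensorProduct in
theorem onSnd_tmul (X : Module.End HSer Phase) (A B : Phase) :
    onSnd X (A ⊗ₜ[HSer] B) = A ⊗ₜ[HSer] X B := LinearMap.lTensor_tmul _ _ _ _

theorem mulPair_tmul (A B : Phase) : mulPair (A ⊗ₜ[HSer] B) = A * B := LinearMap.mul'_apply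

theorem commute_onFst_onSnd (X Y : Module.End HSer Phase) : Commute (onFst X) (onSnd Y) :=
  TensorProduct.ext' fun A B => by
    rw [Module.End.mul_apply, Module.End.mul_apply, onFst_tmul, onSnd_tmul, onSnd_tmul, onFst_tmul]

/-- The operators `∂²/∂x_a∂p_b` on pairs, for `a, b` among the two factors. -/
def pairOp : Fin 2 → Fin 2 → Module.End HSer PhasePair := fun a b =>
  ![onFst dxLin, onSnd dxLin] a * ![onFst dpLin, onSnd dpLin] b

theorem commute_pairOp (a b c d : Fin 2) : Commute (pairOp a b) (pairOp c d) := by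
  have hxx : ∀ a c : Fin 2, Commute (![onFst dxLin, onSnd dxLin] a)
      (![onFst dxLin, onSnd dxLin] c) := by
    intro a c
    fin_cases a <;> fin_cases c
    exacts [Commute.refl _, commute_onFst_onSnd _ _, (commute_onFst_onSnd _ _).symm,
      Commute.refl _]
  have hpp : ∀ a c : Fin 2, Commute (![onFst dpLin, onSnd dpLin] a)
      (![onFst dpLin, onSnd dpLin] c) := by
    intro a c
    fin_cases a <;> fin_cases c
    exacts [Commute.refl _, commute_onFst_onSnd _ _, (commute_onFst_onSnd _ _).symm,
      Commute.refl _]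
  have hxp : ∀ a c : Fin 2, Commute (![onFst dxLin, onSnd dxLin] a)
      (![onFst dpLin, onSnd dpLin] c) := by
    intro a c
    fin_cases a <;> fin_cases c
    exacts [commute_dxLin_dpLin.map onFst, commute_onFst_onSnd _ _,
      (commute_onFst_onSnd _ _).symm, commute_dxLin_dpLin.map onSnd]
  exact ((hxx a c).mul_right (hxp a d)).mul_left ((hxp c b).symm.mul_right (hpp b d))

/-- The Leibniz rule for two derivatives gives four terms, one for each choice of the factor hit by
`∂_x` and the factor hit by `∂_p`. It turns an operator acting after multiplication into one acting
on pairs. -/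
theorem mulPair_dxdp (τ : PhasePair) : dxdp (mulPair τ) =
    mulPair ((pairOp 0 0 + pairOp 0 1 + pairOp 1 0 + pairOp 1 1) τ) := by
  induction τ using TensorProduct.induction_on with
  | zero => simp only [map_zero]
  | add σ τ hσ hτ => simp only [map_add, hσ, hτ]
  | tmul A B =>
    simp only [LinearMap.add_apply, map_add]
    simp only [pairOp, Matrix.cons_val_zero, Matrix.cons_val_one, Module.End.mul_apply,
      onFst_tmul, onSnd_tmul, mulPair_tmul, dxdp]
    simp only [dxLin_apply, dpLin_apply, Derivation.leibniz, smul_eq_mul, map_add]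
    ring

theorem pow_smul_dxdp_mulPair (c : HSer) (n : ℕ) (τ : PhasePair) :
    ((c • dxdp) ^ n) (mulPair τ) =
      mulPair (((c • (pairOp 0 0 + pairOp 0 1 + pairOp 1 0 + pairOp 1 1)) ^ n) τ) := by
  induction n generalizing τ with
  | zero => simp
  | succ n ih =>
    rw [pow_succ, pow_succ, Module.End.mul_apply, Module.End.mul_apply, ← ih,
      LinearMap.smul_apply, LinearMap.smul_apply, mulPair_dxdp, map_smul mulPair]

theorem coeff_expEnd_smul_dxdp_mulPair (c : HSer) (n : ℕ) (τ : PhasePair) :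
    PowerSeries.coeff n (expEnd (c • dxdp)) (mulPair τ) =
      mulPair (PowerSeries.coeff n
        (expEnd (c • (pairOp 0 0 + pairOp 0 1 + pairOp 1 0 + pairOp 1 1))) τ) := by
  rw [coeff_expEnd, coeff_expEnd, LinearMap.smul_apply, LinearMap.smul_apply, map_smul,
    pow_smul_dxdp_mulPair]

theorem poissonPow_eq (r : ℕ) (A B : Phase) : poissonPow r A B =
    mulPair (((pairOp 0 1 - pairOp 1 0) ^ r) (A ⊗ₜ[HSer] B)) := by
  induction r generalizing A B with
  | zero => rw [pow_zero, Module.End.one_apply, mulPair_tmul, poissonPow]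
  | succ r ih =>
    rw [poissonPow, ih, ih, ← map_sub, ← map_sub, pow_succ, Module.End.mul_apply]
    congr 2

theorem moyal_eq (A B : Phase) : moyal A B = hbarSum fun r => mulPair (PowerSeries.coeff r
    (expEnd (cst (Complex.I / 2) • (pairOp 0 1 - pairOp 1 0))) (A ⊗ₜ[HSer] B)) := by
  rw [moyal]
  congr 1
  funext r
  rw [coeff_expEnd, smul_pow, smul_smul, LinearMap.smul_apply, map_smul, ← poissonPow_eq,
    ← cst_pow, ← cst_mul, mul_comm, mul_one_div]

theorem hbarSum_coeff_mul (Φ Ψ : PowerSeries (Module.End HSer PhasePair))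
    (Λ : PhasePair →ₗ[HSer] Phase) (τ : PhasePair) :
    (hbarSum fun r => hbarSum fun s =>
      Λ (PowerSeries.coeff r Φ (PowerSeries.coeff s Ψ τ))) =
    hbarSum fun n => Λ (PowerSeries.coeff n (Φ * Ψ) τ) := by
  rw [hbarSum_hbarSum]
  congr 1
  funext n
  rw [PowerSeries.coeff_mul, Finset.Nat.sum_antidiagonal_eq_sum_range_succ_mk,
    LinearMap.sum_apply, map_sum]
  rfl

theorem coeff_expEnd_smul_onFst (c : HSer) (n : ℕ) (A B : Phase) :
    PowerSeries.coeff n (expEnd (c • pairOp 0 0)) (A ⊗ₜ[HSer] B) =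
      (PowerSeries.coeff n (expEnd (c • dxdp)) A) ⊗ₜ[HSer] B := by
  have h : pairOp 0 0 = onFst dxdp := by rw [dxdp, map_mul]; rfl
  rw [coeff_expEnd, coeff_expEnd, h, ← map_smul onFst, ← map_pow, ← map_smul onFst, onFst_tmul]

theorem coeff_expEnd_smul_onSnd (c : HSer) (n : ℕ) (A B : Phase) :
    PowerSeries.coeff n (expEnd (c • pairOp 1 1)) (A ⊗ₜ[HSer] B) =
      A ⊗ₜ[HSer] (PowerSeries.coeff n (expEnd (c • dxdp)) B) := by
  have h : pairOp 1 1 = onSnd dxdp := by rw [dxdp, map_mul]; rfl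
  rw [coeff_expEnd, coeff_expEnd, h, ← map_smul onSnd, ← map_pow, ← map_smul onSnd, onSnd_tmul]

/-- The product of phase space series for which normal ordering is multiplicative:
`∑ n, (i ħ)^n / n! (∂/∂x)^n A (∂/∂p)^n B`. -/
def nstar (A B : Phase) : Phase :=
  hbarSum fun n => cst (Complex.I ^ n / (n.factorial : ℂ)) • ((dxLin ^ n) A * (dpLin ^ n) B)

theorem nstar_eq (A B : Phase) : nstar A B = hbarSum fun r => mulPair (PowerSeries.coeff r
    (expEnd (cst Complex.I • pairOp 0 1)) (A ⊗ₜ[HSer] B)) := by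
  rw [nstar]
  congr 1
  funext r
  have h : pairOp 0 1 = onFst dxLin * onSnd dpLin := rfl
  rw [coeff_expEnd, smul_pow, smul_smul, LinearMap.smul_apply, map_smul, h,
    (commute_onFst_onSnd _ _).mul_pow, ← map_pow onFst, ← map_pow onSnd, Module.End.mul_apply, onSnd_tmul,
    onFst_tmul, mulPair_tmul, ← cst_pow, ← cst_mul, mul_comm (1 / _), mul_one_div]

/-- The ordering operators on the arguments become exponentials acting on the first and second
tensor factor. -/
theorem moyal_diffOp_expSer (c : ℂ) (A B : Phase) :
    moyal (diffOp (expSer c) A) (diffOp (expSer c) B) =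
      hbarSum fun n => mulPair (PowerSeries.coeff n
        (expEnd (cst (Complex.I / 2) • (pairOp 0 1 - pairOp 1 0)) *
          (expEnd (cst (-c) • pairOp 0 0) * expEnd (cst (-c) • pairOp 1 1))) (A ⊗ₜ[HSer] B)) := by
  rw [← hbarSum_coeff_mul, moyal_eq]
  congr 1
  funext r
  set Λ := mulPair ∘ₗ PowerSeries.coeff r
    (expEnd (cst (Complex.I / 2) • (pairOp 0 1 - pairOp 1 0))) with hΛ
  change Λ _ = hbarSum fun s => Λ _
  rw [← hbarSum_coeff_mul, diffOp_expSer c A]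
  -- With the other factor held fixed, each argument enters linearly over `ℂ[[ħ]]`, so its formal
  -- sum can be pulled out.
  have h1 := map_hbarSum (Λ ∘ₗ (TensorProduct.mk HSer Phase Phase).flip (diffOp (expSer c) B))
    fun s => PowerSeries.coeff s (expEnd (cst (-c) • dxdp)) A
  refine h1.trans ?_
  congr 1
  funext s
  rw [diffOp_expSer c B]
  have h2 := map_hbarSum (Λ ∘ₗ TensorProduct.mk HSer Phase Phase
    (PowerSeries.coeff s (expEnd (cst (-c) • dxdp)) A))
    fun t => PowerSeries.coeff t (expEnd (cst (-c) • dxdp)) B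
  refine h2.trans ?_
  congr 1
  funext t
  rw [coeff_expEnd_smul_onSnd, coeff_expEnd_smul_onFst]
  rfl

/-- The exponents add: `X 0 0`, `X 1 1` and `X 1 0` cancel, and `X 0 1` is doubled. With `z = i/2`
the factors are, in order, the inverse ordering operator on the product, the Moyal exponential, and
the ordering operators on the two arguments. -/
theorem expEnd_mul_expEnd_moyal {E : Type*} [Ring E] [Algebra HSer E] (X : Fin 2 → Fin 2 → E)
    (hX : ∀ a b c d, Commute (X a b) (X c d)) (z : HSer) :
    expEnd (z • (X 0 0 + X 0 1 + X 1 0 + X 1 1)) * (expEnd (z • (X 0 1 - X 1 0)) *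
      (expEnd ((-z) • X 0 0) * expEnd ((-z) • X 1 1))) = expEnd ((z + z) • X 0 1) := by
  have h1 : Commute (X 0 1 - X 1 0) (X 0 0 + X 1 1) :=
    ((hX _ _ _ _).sub_left (hX _ _ _ _)).add_right ((hX _ _ _ _).sub_left (hX _ _ _ _))
  have h2 : ∀ a b, Commute (X a b) (z • (X 0 1 - X 1 0) + (-z) • (X 0 0 + X 1 1)) := fun a b =>
    (((hX _ _ _ _).sub_right (hX _ _ _ _)).smul_right z).add_right
      (((hX _ _ _ _).add_right (hX _ _ _ _)).smul_right (-z))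
  rw [expEnd_mul (((hX _ _ _ _).smul_right _).smul_left _), ← smul_add (-z),
    expEnd_mul ((h1.smul_right _).smul_left _),
    expEnd_mul (((((h2 _ _).add_left (h2 _ _)).add_left (h2 _ _)).add_left (h2 _ _)).smul_left z)]
  congr 1
  simp only [smul_add, smul_sub, neg_smul, add_smul]
  abel

theorem diffOp_moyal_diffOp (A B : Phase) :
    diffOp (expSer (Complex.I / 2))⁻¹
      (moyal (diffOp (expSer (Complex.I / 2)) A) (diffOp (expSer (Complex.I / 2)) B)) =
    nstar A B := by
  rw [moyal_diffOp_expSer, expSer_inv, diffOp_expSer, neg_neg, nstar_eq]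
  simp only [map_hbarSum, coeff_expEnd_smul_dxdp_mulPair]
  have h := expEnd_mul_expEnd_moyal pairOp commute_pairOp (cst (Complex.I / 2))
  rw [← map_add, add_halves, ← map_neg] at h
  rw [hbarSum_coeff_mul]
  refine congrArg hbarSum (funext fun n => ?_)
  exact congrArg (fun Φ : PowerSeries (Module.End HSer PhasePair) => mulPair (PowerSeries.coeff n Φ (A ⊗ₜ[HSer] B))) h

theorem gstar_eq (f : PowerSeries ℂ) (A B : Phase) :
    gstar f A B = diffOp f⁻¹ (nstar (diffOp f A) (diffOp f B)) := by
  rw [gstar, alpha, PowerSeries.mul_inv_rev, mul_comm f, mul_comm _ f⁻¹, ← diffOp_diffOp,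
    ← diffOp_diffOp, ← diffOp_diffOp, diffOp_moyal_diffOp]

/-! ### Filtration and monomials of phase space -/

namespace Phase

/-- The phase space series all of whose terms have weight at least `N`, where `x` and `p` have
weight `1` and `ħ` has weight `2`. -/
def filtr (N : ℕ) : Submodule HSer Phase where
  carrier := {A | ∀ (e : Fin 2 →₀ ℕ) K, e 0 + e 1 + 2 * K < N →
    PowerSeries.coeff K (MvPowerSeries.coeff e A) = 0}
  add_mem' hA hB e K h := by rw [map_add, map_add, hA e K h, hB e K h, add_zero]
  zero_mem' e K _ := by rw [map_zero, map_zero]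
  smul_mem' r A hA e K h := by
    rw [MvPowerSeries.coeff_smul]
    exact coeff_mul_eq_zero_of_le r fun q hq => hA e q (by omega)

theorem mem_filtr_zero (A : Phase) : A ∈ filtr 0 := fun _ _ h => absurd h (Nat.not_lt_zero _)

theorem eq_zero_of_mem_filtr (A : Phase) (h : ∀ N, A ∈ filtr N) : A = 0 := by
  refine Phase.ext fun e K => ?_
  rw [map_zero, map_zero]
  exact h (e 0 + e 1 + 2 * K + 1) e K (Nat.lt_succ_self _)

theorem filtr_mono {N N' : ℕ} (h : N ≤ N') {A : Phase} (hA : A ∈ filtr N') : A ∈ filtr N :=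
  fun e K hK => hA e K (hK.trans_le h)

theorem mul_mem_filtr {M N : ℕ} {A B : Phase} (hA : A ∈ filtr M) (hB : B ∈ filtr N) :
    A * B ∈ filtr (M + N) := by
  classical
  intro e K h
  rw [MvPowerSeries.coeff_mul, map_sum]
  refine Finset.sum_eq_zero fun x hx => coeff_mul_eq_zero_of_add fun q t hqt => ?_
  have hx : x.1 + x.2 = e := by simpa using hx
  have h0 : x.1 0 + x.2 0 = e 0 := by rw [← hx, Finsupp.add_apply]
  have h1 : x.1 1 + x.2 1 = e 1 := by rw [← hx, Finsupp.add_apply]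
  by_cases hM : x.1 0 + x.1 1 + 2 * q < M
  · exact Or.inl (hA _ _ hM)
  · exact Or.inr (hB _ _ (by omega))

theorem hbar_pow_smul_mem_filtr {N : ℕ} (r : ℕ) {A : Phase} (hA : A ∈ filtr N) :
    (hbar ^ r : HSer) • A ∈ filtr (N + 2 * r) := by
  intro e K h
  rw [MvPowerSeries.coeff_smul, PowerSeries.coeff_X_pow_mul']
  split_ifs with hr
  · exact hA e _ (by omega)
  · rfl

theorem pderiv_mem_filtr {N : ℕ} {A : Phase} (i : Fin 2) (hA : A ∈ filtr (N + 1)) :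
    MvPowerSeries.pderiv HSer i A ∈ filtr N := by
  intro e K h
  rw [MvPowerSeries.coeff_pderiv, mul_comm]
  refine coeff_mul_eq_zero_of_le _ fun q hq => hA _ _ ?_
  fin_cases i <;> simp <;> omega

theorem pderiv_pow_mem_filtr {N : ℕ} (i : Fin 2) (r : ℕ) {A : Phase} (hA : A ∈ filtr N) :
    ((MvPowerSeries.pderiv HSer i).toLinearMap ^ r : Module.End HSer Phase) A ∈
      filtr (N - r) := by
  induction r with
  | zero => exact hA
  | succ r ih =>
    rw [pow_succ', Module.End.mul_apply]
    by_cases h : N ≤ r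
    · rw [Nat.sub_eq_zero_of_le (by omega)]
      exact mem_filtr_zero _
    · refine pderiv_mem_filtr i ?_
      rwa [show N - (r + 1) + 1 = N - r by omega]

theorem X_mem_filtr (i : Fin 2) : (MvPowerSeries.X i : Phase) ∈ filtr 1 := by
  classical
  intro e K h
  rw [MvPowerSeries.coeff_X, if_neg, map_zero]
  rintro rfl
  fin_cases i <;> simp at h

theorem hbarSum_mem_filtr {N : ℕ} {T : ℕ → Phase} (h : ∀ r, T r ∈ filtr (N - 2 * r)) :
    hbarSum T ∈ filtr N := by
  intro e K hK
  rw [coeff_hbarSum]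
  refine Finset.sum_eq_zero fun r hr => h r e _ ?_
  have := Finset.mem_range.1 hr
  omega

/-- The exponent of the monomial `p^m x^n`. -/
def expo (m n : ℕ) : Fin 2 →₀ ℕ := Finsupp.single 0 n + Finsupp.single 1 m

theorem expo_apply_zero (m n : ℕ) : expo m n 0 = n := by simp [expo]

theorem expo_apply_one (m n : ℕ) : expo m n 1 = m := by simp [expo]

theorem expo_eta (e : Fin 2 →₀ ℕ) : expo (e 1) (e 0) = e := by
  ext i
  fin_cases i
  · exact expo_apply_zero _ _
  · exact expo_apply_one _ _

theorem expo_inj {m n m' n' : ℕ} : expo m n = expo m' n' ↔ m = m' ∧ n = n' := by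
  refine ⟨fun h => ⟨?_, ?_⟩, fun h => by rw [h.1, h.2]⟩
  · rw [← expo_apply_one m n, h, expo_apply_one]
  · rw [← expo_apply_zero m n, h, expo_apply_zero]

theorem monomial_eq (m n : ℕ) : pv ^ m * xv ^ n = MvPowerSeries.monomial (expo m n) (1 : HSer) := by
  rw [MvPowerSeries.X_pow_eq, MvPowerSeries.X_pow_eq, MvPowerSeries.monomial_mul_monomial,
    add_comm, one_mul]
  rfl

theorem coeff_monomial (m n : ℕ) (e : Fin 2 →₀ ℕ) :
    MvPowerSeries.coeff e (pv ^ m * xv ^ n) = if e = expo m n then 1 else 0 := by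
  classical
  rw [monomial_eq, MvPowerSeries.coeff_monomial]

/-- The terms of a phase space series with exponents less than `N`. -/
def trunc (N : ℕ) (A : Phase) : Phase :=
  ∑ m ∈ Finset.range N, ∑ n ∈ Finset.range N,
    MvPowerSeries.coeff (expo m n) A • (pv ^ m * xv ^ n)

theorem sub_trunc_mem (N : ℕ) (A : Phase) : A - trunc N A ∈ filtr N := by
  intro e K h
  have h1 : MvPowerSeries.coeff e (trunc N A) = MvPowerSeries.coeff e A := by
    rw [trunc, map_sum, Finset.sum_eq_single (e 1), map_sum, Finset.sum_eq_single (e 0),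
      MvPowerSeries.coeff_smul, coeff_monomial, expo_eta, if_pos rfl, mul_one]
    · intro n _ hn
      rw [MvPowerSeries.coeff_smul, coeff_monomial, if_neg, mul_zero]
      exact fun he => hn (by rw [he, expo_apply_zero])
    · exact fun h' => absurd (Finset.mem_range.2 (by omega)) h'
    · intro m _ hm
      rw [map_sum]
      refine Finset.sum_eq_zero fun n _ => ?_
      rw [MvPowerSeries.coeff_smul, coeff_monomial, if_neg, mul_zero]
      exact fun he => hm (by rw [he, expo_apply_one])
    · exact fun h' => absurd (Finset.mem_range.2 (by omega)) h'
  rw [map_sub, h1, sub_self, map_zero]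

/-- Two linear maps that are continuous for a separated filtration are equal if they agree on
monomials. -/
theorem linear_ext {M : Type*} [AddCommGroup M] [Module HSer M] (G : ℕ → Submodule HSer M)
    (hG : ∀ x, (∀ N, x ∈ G N) → x = 0) {T U : Phase →ₗ[HSer] M}
    (hT : ∀ N, ∀ A ∈ filtr N, T A ∈ G N) (hU : ∀ N, ∀ A ∈ filtr N, U A ∈ G N)
    (h : ∀ m n, T (pv ^ m * xv ^ n) = U (pv ^ m * xv ^ n)) (A : Phase) : T A = U A := by
  rw [← sub_eq_zero]
  refine hG _ fun N => ?_
  have h1 : T (trunc N A) = U (trunc N A) := by simp only [trunc, map_sum, map_smul, h]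
  have h2 := sub_mem (hT N _ (sub_trunc_mem N A)) (hU N _ (sub_trunc_mem N A))
  rwa [map_sub, map_sub, h1, sub_sub_sub_cancel_right] at h2

end Phase

/-! ### Normal ordering -/

/-- Normal ordering as a linear map. -/
def normalOrderLin : Phase →ₗ[HSer] NC where
  toFun := normalOrder
  map_add' A B := NC.ext fun w => by
    rw [NC.add_apply]
    simp only [normalOrder]
    split_ifs <;> simp
  map_smul' r A := NC.ext fun w => by
    rw [RingHom.id_apply, NC.smul_apply]
    simp only [normalOrder]
    split_ifs <;> simp

theorem normalOrder_mem_filtr {N : ℕ} {A : Phase} (hA : A ∈ Phase.filtr N) :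
    normalOrder A ∈ NC.filtr N := by
  intro w k h
  rw [normalOrder]
  split_ifs with hw
  · refine hA _ _ ?_
    rw [hw] at h
    simpa [add_comm] using h
  · exact map_zero _

theorem normalOrder_monomial (m n : ℕ) :
    normalOrder (pv ^ m * xv ^ n) = NC.letter 1 ^ m * NC.letter 0 ^ n := by
  rw [← NC.word_replicate, ← NC.word_replicate, ← NC.word_append]
  apply NC.ext
  intro w
  rw [normalOrder, NC.word_apply, Phase.coeff_monomial]
  by_cases h : w = List.replicate m 1 ++ List.replicate n 0
  · have h0 : w.count 0 = n := by simp [h, List.count_replicate]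
    have h1 : w.count 1 = m := by simp [h, List.count_replicate]
    rw [h0, h1, if_pos h]
    exact (if_pos rfl).trans (if_pos h).symm
  · rw [if_neg h]
    split_ifs with h1 h2
    · have h3 : List.count 1 w = m ∧ List.count 0 w = n := Phase.expo_inj.1 h2
      rw [h3.1, h3.2] at h1
      exact absurd h1 h
    · rfl
    · rfl

/-! ### The completed Heisenberg algebra and its separated filtration. -/

namespace Heis

/-- The quotient map as a homomorphism of algebras. -/
def mkAlg : NC →ₐ[HSer] Heis := heisIdeal.ringCon.mkₐ (α := HSer)

theorem mkAlg_apply (c : NC) : mkAlg c = mk c := rfl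

theorem mk_surjective : Function.Surjective mk := heisIdeal.ringCon.mk'_surjective

theorem mk_eq_mk {c d : NC} : mk c = mk d ↔ c - d ∈ heisIdeal :=
  (RingCon.eq _).trans (TwoSidedIdeal.rel_iff _ _ _)

theorem isFormallyClosed_heisIdeal : IsFormallyClosed heisIdeal := by
  intro c hc
  rw [heisIdeal, TwoSidedIdeal.mem_sInf]
  intro I hI
  refine hI.1 c fun N => ?_
  obtain ⟨d, hd, h⟩ := hc N
  rw [heisIdeal, TwoSidedIdeal.mem_sInf] at hd
  exact ⟨d, hd I hI, h⟩

/-- The images of the formal series of weight at least `N`. -/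
def filtr (N : ℕ) : Submodule HSer Heis := (NC.filtr N).map mkAlg.toLinearMap

theorem mk_mem_filtr {N : ℕ} {c : NC} (hc : c ∈ NC.filtr N) : mk c ∈ filtr N := ⟨c, hc, rfl⟩

/-- The quotient is separated exactly because the ideal is closed. -/
theorem eq_zero_of_mem_filtr (x : Heis) (h : ∀ N, x ∈ filtr N) : x = 0 := by
  obtain ⟨c, rfl⟩ := mk_surjective x
  suffices hc : c ∈ heisIdeal from mk_eq_mk.2 (by rwa [sub_zero])
  refine isFormallyClosed_heisIdeal c fun N => ?_
  -- Closedness is stated with `ħ` of degree `1`, the filtration with weight `2`; from `|w| + k < N`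
  -- follows `|w| + 2k < 2N`.
  obtain ⟨d, hd, h'⟩ := h (2 * N)
  refine ⟨c - d, mk_eq_mk.1 (Eq.symm h'), fun w k hw => ?_⟩
  rw [NC.sub_apply, map_sub, hd w k (by omega), sub_zero]

theorem mul_mem_filtr {N : ℕ} (x : Heis) {y : Heis} (hy : y ∈ filtr N) : x * y ∈ filtr N := by
  obtain ⟨c, rfl⟩ := mk_surjective x
  obtain ⟨d, hd, rfl⟩ := hy
  exact ⟨c * d, NC.mul_filtr c hd, map_mul mkAlg c d⟩

theorem mem_filtr_mul {N : ℕ} {x : Heis} (hx : x ∈ filtr N) (y : Heis) : x * y ∈ filtr N := by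
  obtain ⟨d, rfl⟩ := mk_surjective y
  obtain ⟨c, hc, rfl⟩ := hx
  exact ⟨c * d, NC.filtr_mul hc d, map_mul mkAlg c d⟩

theorem xhat_mul_phat : xhat * phat = phat * xhat + (cst Complex.I * hbar) • (1 : Heis) := by
  have h : NC.letter 0 * NC.letter 1 - NC.letter 1 * NC.letter 0
      - (cst Complex.I * hbar) • (1 : NC) ∈ heisIdeal := by
    rw [heisIdeal, TwoSidedIdeal.mem_sInf]
    exact fun I hI => hI.2
  rw [sub_sub] at h
  have h1 := mk_eq_mk.2 h
  rwa [← mkAlg_apply, ← mkAlg_apply, map_mul, map_add, map_mul, map_smul, map_one] at h1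

theorem xhat_mul_phat_pow (m : ℕ) : xhat * phat ^ m =
    phat ^ m * xhat + ((m : HSer) * (cst Complex.I * hbar)) • phat ^ (m - 1) := by
  induction m with
  | zero => simp
  | succ m ih =>
    rw [pow_succ', ← mul_assoc, xhat_mul_phat, add_mul, mul_assoc, ih, smul_mul_assoc, one_mul,
      mul_add, mul_smul_comm, ← mul_assoc, Nat.add_sub_cancel, add_assoc]
    congr 1
    rcases m with _ | m
    · simp
    · rw [Nat.add_sub_cancel, ← pow_succ', ← add_smul]
      congr 1
      push_cast
      ring

end Heis

/-! ### Normally ordered symbols: left multiplication by the generators, and surjectivity. -/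

/-- The normally ordered element of the operator algebra with a given symbol. -/
def ordered : Phase →ₗ[HSer] Heis := Heis.mkAlg.toLinearMap ∘ₗ normalOrderLin

theorem ordered_apply (A : Phase) : ordered A = Heis.mk (normalOrder A) := rfl

theorem ordered_mem_filtr {N : ℕ} {A : Phase} (hA : A ∈ Phase.filtr N) :
    ordered A ∈ Heis.filtr N := Heis.mk_mem_filtr (normalOrder_mem_filtr hA)

theorem ordered_monomial (m n : ℕ) : ordered (pv ^ m * xv ^ n) = phat ^ m * xhat ^ n := by
  rw [ordered_apply, normalOrder_monomial, ← Heis.mkAlg_apply, map_mul, map_pow, map_pow]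
  rfl

theorem ordered_one : ordered 1 = 1 := by
  have h := ordered_monomial 0 0
  simpa using h

/-- Multiplication by a phase space series. -/
def mulOp (A : Phase) : Module.End HSer Phase := LinearMap.mulLeft HSer A

theorem mulOp_apply (A B : Phase) : mulOp A B = A * B := rfl

/-- Left multiplication by `x̂` on normally ordered symbols. -/
def xOp : Module.End HSer Phase := mulOp xv + (cst Complex.I * hbar) • dpLin

theorem xOp_apply (A : Phase) : xOp A = xv * A + (cst Complex.I * hbar) • dp A := rfl

theorem xOp_mem_filtr {N : ℕ} {A : Phase} (hA : A ∈ Phase.filtr N) :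
    xOp A ∈ Phase.filtr (N + 1) := by
  rw [xOp_apply]
  refine add_mem ?_ ?_
  · rw [add_comm]
    exact Phase.mul_mem_filtr (Phase.X_mem_filtr 0) hA
  · rw [mul_smul]
    refine Submodule.smul_mem _ _ ?_
    have h1 := Phase.hbar_pow_smul_mem_filtr 1 (Phase.pderiv_pow_mem_filtr 1 1 hA)
    rw [pow_one, pow_one] at h1
    -- The derivative costs one unit of weight and `ħ` brings two, a net gain of one.
    exact Phase.filtr_mono (by omega) h1

theorem mulOp_pv_mem_filtr {N : ℕ} {A : Phase} (hA : A ∈ Phase.filtr N) :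
    mulOp pv A ∈ Phase.filtr (N + 1) := by
  rw [mulOp_apply, add_comm]
  exact Phase.mul_mem_filtr (Phase.X_mem_filtr 1) hA

theorem dp_monomial (m n : ℕ) : dp (pv ^ m * xv ^ n) = (m : HSer) • (pv ^ (m - 1) * xv ^ n) := by
  simp only [Derivation.leibniz]
  rw [MvPowerSeries.pderiv_pow, MvPowerSeries.pderiv_pow,
    MvPowerSeries.pderiv_X_self, MvPowerSeries.pderiv_X_of_ne (by decide)]
  simp only [smul_eq_mul, mul_zero, zero_add, mul_one, Nat.cast_smul_eq_nsmul, nsmul_eq_mul]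
  ring

theorem dx_monomial (m n : ℕ) : dx (pv ^ m * xv ^ n) = (n : HSer) • (pv ^ m * xv ^ (n - 1)) := by
  simp only [Derivation.leibniz]
  rw [MvPowerSeries.pderiv_pow, MvPowerSeries.pderiv_pow,
    MvPowerSeries.pderiv_X_self, MvPowerSeries.pderiv_X_of_ne (by decide)]
  simp only [smul_eq_mul, mul_zero, add_zero, mul_one, Nat.cast_smul_eq_nsmul, nsmul_eq_mul]
  ring

theorem phat_mul_ordered (A : Phase) : phat * ordered A = ordered (mulOp pv A) := by
  refine Phase.linear_ext Heis.filtr Heis.eq_zero_of_mem_filtr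
    (T := LinearMap.mulLeft HSer phat ∘ₗ ordered) (U := ordered ∘ₗ mulOp pv)
    (fun N A hA => Heis.mul_mem_filtr phat (ordered_mem_filtr hA))
    (fun N A hA => ordered_mem_filtr (Phase.filtr_mono (Nat.le_succ N) (mulOp_pv_mem_filtr hA)))
    (fun m n => ?_) A
  change phat * ordered (pv ^ m * xv ^ n) = ordered (pv * (pv ^ m * xv ^ n))
  rw [← mul_assoc, ← pow_succ', ordered_monomial, ordered_monomial, ← mul_assoc, ← pow_succ']

/-- On monomials this is the commutation of `x̂` past `p̂^m`, whose correction `m iħ p̂^(m-1)` is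
`iħ ∂_p`; continuity extends it to all series. -/
theorem xhat_mul_ordered (A : Phase) : xhat * ordered A = ordered (xOp A) := by
  refine Phase.linear_ext Heis.filtr Heis.eq_zero_of_mem_filtr
    (T := LinearMap.mulLeft HSer xhat ∘ₗ ordered) (U := ordered ∘ₗ xOp)
    (fun N A hA => Heis.mul_mem_filtr xhat (ordered_mem_filtr hA))
    (fun N A hA => ordered_mem_filtr (Phase.filtr_mono (Nat.le_succ N) (xOp_mem_filtr hA)))
    (fun m n => ?_) A
  change xhat * ordered (pv ^ m * xv ^ n) = ordered (xOp (pv ^ m * xv ^ n))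
  rw [xOp_apply, dp_monomial, mul_left_comm, ← pow_succ', map_add, map_smul, map_smul,
    ordered_monomial, ordered_monomial, ordered_monomial, ← mul_assoc, Heis.xhat_mul_phat_pow,
    add_mul, mul_assoc, ← pow_succ', smul_mul_assoc, smul_smul, mul_comm (m : HSer)]

/-- The symbol of a word. -/
def ordWord (w : List (Fin 2)) : Phase := (w.map ![xOp, mulOp pv]).prod 1

theorem ordWord_cons (a : Fin 2) (w : List (Fin 2)) :
    ordWord (a :: w) = ![xOp, mulOp pv] a (ordWord w) := by
  rw [ordWord, List.map_cons, List.prod_cons]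
  rfl

theorem ordWord_mem_filtr (w : List (Fin 2)) : ordWord w ∈ Phase.filtr w.length := by
  induction w with
  | nil => exact Phase.mem_filtr_zero _
  | cons a w ih =>
    rw [ordWord_cons, List.length_cons]
    fin_cases a
    · exact xOp_mem_filtr ih
    · exact mulOp_pv_mem_filtr ih

theorem ordered_ordWord (w : List (Fin 2)) : ordered (ordWord w) = Heis.mk (NC.word w) := by
  induction w with
  | nil => exact ordered_one
  | cons a w ih =>
    rw [ordWord_cons, NC.word_cons, ← Heis.mkAlg_apply, map_mul, Heis.mkAlg_apply,
      Heis.mkAlg_apply, ← ih]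
    fin_cases a
    · exact (xhat_mul_ordered _).symm
    · exact (phat_mul_ordered _).symm

theorem coeff_ordWord (e : Fin 2 →₀ ℕ) (w : List (Fin 2)) (K : ℕ)
    (h : e 0 + e 1 + 2 * K < w.length) :
    PowerSeries.coeff K (MvPowerSeries.coeff e (ordWord w)) = 0 :=
  ordWord_mem_filtr w e K h

/-- The symbol of a non-commutative formal series. -/
def symbol : NC →ₗ[HSer] Phase where
  toFun c := fun e => seriesAt (e 0 + e 1) (fun w => MvPowerSeries.coeff e (ordWord w)) c
  map_add' c d := funext fun _ => seriesAt_add c d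
  map_smul' r c := funext fun e => seriesAt_smul (coeff_ordWord e) r c

theorem coeff_symbol (c : NC) (e : Fin 2 →₀ ℕ) : MvPowerSeries.coeff e (symbol c) =
    seriesAt (e 0 + e 1) (fun w => MvPowerSeries.coeff e (ordWord w)) c := rfl

theorem symbol_word (w : List (Fin 2)) : symbol (NC.word w) = ordWord w :=
  MvPowerSeries.ext fun e => by rw [coeff_symbol, seriesAt_word (coeff_ordWord e)]

theorem symbol_mem_filtr {N : ℕ} {c : NC} (hc : c ∈ NC.filtr N) : symbol c ∈ Phase.filtr N :=
  fun e _ h => coeff_seriesAt_of_mem_filtr (coeff_ordWord e) hc h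

/-- On a word, reordering letter by letter gives the normally ordered form; continuity passes to
series. Hence every class in `Heis` has a normally ordered representative. -/
theorem ordered_symbol (c : NC) : ordered (symbol c) = Heis.mk c :=
  NC.linear_ext Heis.filtr Heis.eq_zero_of_mem_filtr (T := ordered ∘ₗ symbol)
    (U := Heis.mkAlg.toLinearMap) (fun _ _ hc => ordered_mem_filtr (symbol_mem_filtr hc))
    (fun _ _ hc => Heis.mk_mem_filtr hc)
    (fun w => (congrArg ordered (symbol_word w)).trans (ordered_ordWord w)) c

theorem ordered_surjective : Function.Surjective ordered := fun x => by
  obtain ⟨c, rfl⟩ := Heis.mk_surjective x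
  exact ⟨symbol c, ordered_symbol c⟩

/-! ### Multiplicativity of normal ordering. -/

theorem hbar_smul_hbarSum (T : ℕ → Phase) :
    (hbar : HSer) • hbarSum T = hbarSum fun n => if n = 0 then 0 else T (n - 1) := by
  rw [hbarSum_eq_sum_add (fun n => if n = 0 then 0 else T (n - 1)) 1]
  simp

theorem nstar_add_left (A A' B : Phase) : nstar (A + A') B = nstar A B + nstar A' B := by
  simp only [nstar, map_add, add_mul, smul_add, hbarSum_add]

theorem nstar_smul_left (r : HSer) (A B : Phase) : nstar (r • A) B = r • nstar A B := by
  simp only [nstar, map_smul, smul_mul_assoc, smul_comm _ r, hbarSum_smul]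

/-- The `r`-th term loses at most `r` units of the weight of `A` and gains `2r` from `ħ^r`; this is
continuity in the left argument. -/
theorem nstar_mem_filtr {N : ℕ} {A : Phase} (hA : A ∈ Phase.filtr N) (B : Phase) :
    nstar A B ∈ Phase.filtr N := by
  refine Phase.hbarSum_mem_filtr fun r => Submodule.smul_mem _ _ (Phase.filtr_mono ?_
    (Phase.mul_mem_filtr (Phase.pderiv_pow_mem_filtr 0 r hA) (Phase.mem_filtr_zero _)))
  omega

theorem dxLin_pow_xv_mul (r : ℕ) (A : Phase) : (dxLin ^ r) (xv * A) =
    xv * (dxLin ^ r) A + (r : HSer) • (dxLin ^ (r - 1)) A := by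
  induction r with
  | zero => simp
  | succ r ih =>
    rw [pow_succ', Module.End.mul_apply, Module.End.mul_apply, ih, map_add, map_smul,
      Nat.add_sub_cancel]
    have h1 : dxLin (xv * (dxLin ^ r) A) = xv * dxLin ((dxLin ^ r) A) + (dxLin ^ r) A := by
      simp only [dxLin_apply, Derivation.leibniz, MvPowerSeries.pderiv_X_self, smul_eq_mul, mul_one]
    have h2 : (r : HSer) • dxLin ((dxLin ^ (r - 1)) A) = (r : HSer) • (dxLin ^ r) A := by
      rcases r with _ | r
      · simp
      · rw [← Module.End.mul_apply, ← pow_succ', Nat.add_sub_cancel]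
    rw [h1, h2, Nat.cast_succ, add_smul, one_smul]
    abel

theorem dpLin_pow_xv_mul (r : ℕ) (A : Phase) : (dpLin ^ r) (xv * A) = xv * (dpLin ^ r) A := by
  induction r with
  | zero => simp
  | succ r ih =>
    rw [pow_succ', Module.End.mul_apply, Module.End.mul_apply, ih]
    simp [dpLin_apply]

/-- The Leibniz term `n ∂_x^(n-1) A`, after a shift of the index by one, is the contribution of `iħ
∂_p` acting on `B`; the factor `x` itself commutes with `∂_p`. -/
theorem nstar_xv_mul (A B : Phase) : nstar (xv * A) B = nstar A (xOp B) := by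
  have h := hbar_smul_hbarSum fun n => cst Complex.I •
    cst (Complex.I ^ n / (n.factorial : ℂ)) • ((dxLin ^ n) A * (dpLin ^ n) (dp B))
  have h1 : nstar A (xOp B) = (hbarSum fun n =>
      cst (Complex.I ^ n / (n.factorial : ℂ)) • ((dxLin ^ n) A * (dpLin ^ n) (xv * B))) +
      (hbar : HSer) • hbarSum fun n => cst Complex.I •
        cst (Complex.I ^ n / (n.factorial : ℂ)) • ((dxLin ^ n) A * (dpLin ^ n) (dp B)) := by
    rw [← hbarSum_smul, ← hbarSum_add, nstar]
    congr 1
    funext n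
    rw [xOp_apply, map_add, map_smul, mul_add, smul_add, mul_smul_comm]
    congr 1
    rw [smul_smul, smul_smul, smul_smul]
    congr 1
    ring
  rw [h1, h, ← hbarSum_add, nstar]
  congr 1
  funext n
  rw [dxLin_pow_xv_mul, dpLin_pow_xv_mul, add_mul, smul_add, mul_left_comm, mul_assoc]
  rcases n with _ | n
  · simp
  · rw [if_neg (Nat.succ_ne_zero n), Nat.add_sub_cancel, smul_mul_assoc, smul_smul, smul_smul,
      ← dpLin_apply, ← Module.End.mul_apply, ← pow_succ]
    congr 2
    · rw [← cst_mul, ← map_natCast (PowerSeries.C : ℂ →+* HSer), ← map_mul]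
      congr 1
      rw [Nat.factorial_succ, pow_succ]
      have h1 : (n.factorial : ℂ) ≠ 0 := Nat.cast_ne_zero.2 (Nat.factorial_ne_zero _)
      have h2 : (n + 1 : ℂ) ≠ 0 := by exact_mod_cast Nat.succ_ne_zero n
      push_cast
      field_simp

theorem dxLin_pow_eq_zero {A : Phase} (h : dx A = 0) {r : ℕ} (hr : 1 ≤ r) : (dxLin ^ r) A = 0 := by
  obtain ⟨r, rfl⟩ := Nat.exists_eq_add_of_le' hr
  rw [pow_succ, Module.End.mul_apply, dxLin_apply, h, map_zero]

theorem dpLin_pow_eq_zero {A : Phase} (h : dp A = 0) {r : ℕ} (hr : 1 ≤ r) : (dpLin ^ r) A = 0 := by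
  obtain ⟨r, rfl⟩ := Nat.exists_eq_add_of_le' hr
  rw [pow_succ, Module.End.mul_apply, dpLin_apply, h, map_zero]

theorem nstar_of_dx_eq_zero {A : Phase} (h : dx A = 0) (B : Phase) : nstar A B = A * B := by
  rw [nstar, hbarSum_eq_sum _ 1 fun r hr => by rw [dxLin_pow_eq_zero h hr, zero_mul, smul_zero]]
  simp

theorem nstar_of_dp_eq_zero (A : Phase) {B : Phase} (h : dp B = 0) : nstar A B = A * B := by
  rw [nstar, hbarSum_eq_sum _ 1 fun r hr => by rw [dpLin_pow_eq_zero h hr, mul_zero, smul_zero]]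
  simp

theorem nstar_pv (A : Phase) : nstar A pv = A * pv + (cst Complex.I * hbar) • dx A := by
  have h : ∀ r, 2 ≤ r → (dpLin ^ r) pv = 0 := by
    intro r hr
    obtain ⟨r, rfl⟩ := Nat.exists_eq_add_of_le' hr
    rw [← Nat.add_assoc _ 1 1, pow_succ, Module.End.mul_apply]
    exact dpLin_pow_eq_zero (by simp [dpLin_apply]) (by omega)
  rw [nstar, hbarSum_eq_sum _ 2 fun r hr => by rw [h r hr, mul_zero, smul_zero]]
  rw [Finset.sum_range_succ, Finset.sum_range_one]
  simp only [pow_zero, pow_one, Module.End.one_apply, dpLin_apply, dxLin_apply,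
    MvPowerSeries.pderiv_X_self, Nat.factorial_zero, Nat.factorial_one, Nat.cast_one, div_one,
    map_one, one_smul, mul_one]
  rw [smul_smul, mul_comm hbar]

/-- Factors `x` move to the right argument one at a time, each becoming `xOp`. What remains on the
left is `p^m`, which `∂_x` annihilates, so it acts by plain multiplication. -/
theorem nstar_monomial (m n : ℕ) (B : Phase) :
    nstar (pv ^ m * xv ^ n) B = (mulOp pv ^ m) ((xOp ^ n) B) := by
  induction n generalizing B with
  | zero =>
    have h : ∀ k : ℕ, (mulOp pv ^ k) B = pv ^ k * B := by
      intro k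
      induction k with
      | zero => simp
      | succ k ih => rw [pow_succ', Module.End.mul_apply, ih, mulOp_apply, pow_succ', mul_assoc]
    rw [pow_zero, mul_one, pow_zero, Module.End.one_apply, h, nstar_of_dx_eq_zero]
    rw [dx, MvPowerSeries.pderiv_pow, MvPowerSeries.pderiv_X_of_ne (by decide), mul_zero]
  | succ n ih =>
    rw [pow_succ', mul_left_comm, nstar_xv_mul, ih, pow_succ, Module.End.mul_apply]

theorem phat_pow_mul_ordered (m : ℕ) (A : Phase) :
    phat ^ m * ordered A = ordered ((mulOp pv ^ m) A) := by
  induction m with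
  | zero => simp
  | succ m ih => rw [pow_succ', mul_assoc, ih, phat_mul_ordered, pow_succ', Module.End.mul_apply]

theorem xhat_pow_mul_ordered (n : ℕ) (A : Phase) :
    xhat ^ n * ordered A = ordered ((xOp ^ n) A) := by
  induction n with
  | zero => simp
  | succ m ih => rw [pow_succ', mul_assoc, ih, xhat_mul_ordered, pow_succ', Module.End.mul_apply]

/-- Normal ordering is multiplicative. -/
theorem ordered_mul (A B : Phase) : ordered A * ordered B = ordered (nstar A B) :=
  Phase.linear_ext Heis.filtr Heis.eq_zero_of_mem_filtr
    (T := LinearMap.mulRight HSer (ordered B) ∘ₗ ordered)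
    (U := ordered ∘ₗ
      { toFun := fun A => nstar A B
        map_add' := fun A A' => nstar_add_left A A' B
        map_smul' := fun r A => nstar_smul_left r A B })
    (fun _ _ hA => Heis.mem_filtr_mul (ordered_mem_filtr hA) (ordered B))
    (fun _ _ hA => ordered_mem_filtr (nstar_mem_filtr hA B))
    (fun m n => by
      change ordered (pv ^ m * xv ^ n) * ordered B = ordered (nstar (pv ^ m * xv ^ n) B)
      rw [ordered_monomial, nstar_monomial, ← phat_pow_mul_ordered, ← xhat_pow_mul_ordered,
        mul_assoc]) A

/-! ### The representation by matrices is faithful -/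

theorem isFormallyClosed_ker_matEval : IsFormallyClosed (TwoSidedIdeal.ker matEval) := by
  intro c hc
  rw [TwoSidedIdeal.mem_ker]
  refine HMat.eq_zero_of_mem_filtr _ fun N => ?_
  obtain ⟨d, hd, h⟩ := hc N
  rw [TwoSidedIdeal.mem_ker] at hd
  have h1 : c - d ∈ NC.filtr N := fun w k hw => by
    rw [NC.sub_apply, map_sub, h w k (by omega), sub_self]
  have h2 := matEval_mem_filtr h1
  rwa [map_sub, hd, sub_zero] at h2

/-- The kernel is a competitor in the definition of `heisIdeal`: it is closed by continuity of
`matEval` and contains the canonical relation. -/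
theorem heisIdeal_le_ker_matEval : heisIdeal ≤ TwoSidedIdeal.ker matEval := by
  refine sInf_le ⟨isFormallyClosed_ker_matEval, ?_⟩
  rw [TwoSidedIdeal.mem_ker, map_sub, map_sub, map_mul, map_mul, map_smul, map_one,
    matEval_letter_zero, matEval_letter_one, raiseMat_momMat_commutator, sub_self]

/-- The substitution of the matrices `a†` and `-i ħ a` for `x̂` and `p̂`. -/
def heisMat : Heis →ₐ[HSer] HMat :=
  heisIdeal.ringCon.liftₐ matEval fun c d h => by
    have h1 := heisIdeal_le_ker_matEval ((TwoSidedIdeal.rel_iff _ _ _).1 h)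
    rw [TwoSidedIdeal.mem_ker, map_sub, sub_eq_zero] at h1
    exact h1

theorem heisMat_mk (c : NC) : heisMat (Heis.mk c) = matEval c := rfl

theorem heisMat_xhat : heisMat xhat = raiseMat := matEval_letter_zero

theorem heisMat_phat : heisMat phat = momMat := matEval_letter_one

theorem HMat.eq_zero_of_smul {r : HSer} (hr : r ≠ 0) {A : HMat} (h : r • A = 0) : A = 0 := by
  apply HMat.ext
  intro j l
  have h1 : r * A.entry j l = 0 := by rw [← HMat.entry_smul, h, HMat.entry_zero]
  exact (mul_eq_zero.1 h1).resolve_left hr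

theorem cst_I_mul_hbar_ne_zero : cst Complex.I * hbar ≠ (0 : HSer) :=
  mul_ne_zero (by simp) PowerSeries.X_ne_zero

/-- The commutator of `x̂` with `ordered B` is `iħ` times `ordered (∂_p B)`. The kernel is an ideal
and `HMat` is torsion-free over `ℂ[[ħ]]`, so `iħ` can be cancelled. -/
theorem heisMat_ordered_dp {B : Phase} (h : heisMat (ordered B) = 0) :
    heisMat (ordered (dp B)) = 0 := by
  have h1 : xhat * ordered B - ordered B * ordered xv =
      (cst Complex.I * hbar) • ordered (dp B) := by
    rw [xhat_mul_ordered, ordered_mul, nstar_of_dp_eq_zero _ (by simp), xOp_apply, ← map_sub,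
      mul_comm xv, add_sub_cancel_left, map_smul]
  have h2 := congrArg heisMat h1
  rw [map_sub, map_mul, map_mul, h, mul_zero, zero_mul, sub_self, map_smul] at h2
  exact HMat.eq_zero_of_smul cst_I_mul_hbar_ne_zero h2.symm

theorem heisMat_ordered_dx {B : Phase} (h : heisMat (ordered B) = 0) :
    heisMat (ordered (dx B)) = 0 := by
  have h1 : ordered B * ordered pv - phat * ordered B =
      (cst Complex.I * hbar) • ordered (dx B) := by
    rw [phat_mul_ordered, ordered_mul, nstar_pv, mulOp_apply, ← map_sub, mul_comm pv,
      add_sub_cancel_left, map_smul]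
  have h2 := congrArg heisMat h1
  rw [map_sub, map_mul, map_mul, h, mul_zero, zero_mul, sub_self, map_smul] at h2
  exact HMat.eq_zero_of_smul cst_I_mul_hbar_ne_zero h2.symm

/-- In row `0` at order `ħ^0` only weight `0` survives, which leaves the empty word. -/
theorem coeff_zero_matEval_entry (c : NC) :
    PowerSeries.coeff 0 ((matEval c).entry 0 0) = PowerSeries.coeff 0 (c []) := by
  have h : wordsLT 1 = {[]} := by
    ext w
    simp [mem_wordsLT]
  rw [matEval_apply, matEvalLin_entry, coeff_seriesAt (coeff_wordMat_entry 0 0) c 0 1 (by omega),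
    h, Finset.sum_singleton, wordMat_nil, HMat.entry_one, if_pos rfl, mul_one]

/-- Differentiation stays in the kernel and lowers the degree of the coefficient examined; the
integer factor it produces is nonzero in `ℂ`. The induction ends at the constant term. -/
theorem coeff_zero_of_heisMat_ordered_eq_zero (n : ℕ) : ∀ (B : Phase) (e : Fin 2 →₀ ℕ),
    e 0 + e 1 = n → heisMat (ordered B) = 0 →
      PowerSeries.coeff 0 (MvPowerSeries.coeff e B) = 0 := by
  induction n with
  | zero =>
    intro B e he h
    have h0 : e = 0 := by
      ext i
      fin_cases i <;> simp <;> omega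
    have h1 := coeff_zero_matEval_entry (normalOrder B)
    rw [← heisMat_mk, ← ordered_apply, h, HMat.entry_zero, map_zero] at h1
    rw [h0, h1]
    simp [normalOrder]
  | succ n ih =>
    intro B e he h
    have key : ∀ i : Fin 2, e i ≠ 0 → heisMat (ordered (MvPowerSeries.pderiv HSer i B)) = 0 →
        PowerSeries.coeff 0 (MvPowerSeries.coeff e B) = 0 := by
      intro i hi hB
      have he' : e - Finsupp.single i 1 + Finsupp.single i 1 = e :=
        tsub_add_cancel_of_le (Finsupp.single_le_iff.2 (Nat.one_le_iff_ne_zero.2 hi))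
      have h1 := ih _ (e - Finsupp.single i 1) (by fin_cases i <;> simp at hi ⊢ <;> omega) hB
      rw [MvPowerSeries.coeff_pderiv, he', PowerSeries.coeff_zero_eq_constantCoeff_apply,
        map_mul, ← PowerSeries.coeff_zero_eq_constantCoeff_apply] at h1
      refine (mul_eq_zero.1 h1).resolve_right ?_
      rw [map_add, map_one, map_natCast]
      exact Nat.cast_add_one_ne_zero _
    by_cases h0 : e 0 = 0
    · exact key 1 (by omega) (heisMat_ordered_dp h)
    · exact key 0 h0 (heisMat_ordered_dx h)

theorem eq_zero_of_heisMat_ordered_eq_zero {B : Phase} (h : heisMat (ordered B) = 0) : B = 0 := by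
  refine Phase.ext fun e K => ?_
  rw [map_zero, map_zero]
  induction K generalizing B with
  | zero => exact coeff_zero_of_heisMat_ordered_eq_zero _ B e rfl h
  | succ K ih =>
    -- The quotient `B / ħ`, which exists because `B` vanishes at order `ħ^0`. It lies in the kernel
    -- too, as `ħ` can be cancelled in `HMat`.
    let B' : Phase := fun e =>
      PowerSeries.mk fun K => PowerSeries.coeff (K + 1) (MvPowerSeries.coeff e B)
    have hB' : ∀ e, MvPowerSeries.coeff e B' =
      PowerSeries.mk fun K => PowerSeries.coeff (K + 1) (MvPowerSeries.coeff e B) := fun _ => rfl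
    have hB : B = (hbar : HSer) • B' := by
      refine Phase.ext fun e K => ?_
      rw [MvPowerSeries.coeff_smul, hB']
      rcases K with _ | K
      · rw [coeff_zero_of_heisMat_ordered_eq_zero _ B e rfl h]
        simp
      · rw [PowerSeries.coeff_succ_X_mul, PowerSeries.coeff_mk]
    rw [hB, map_smul, map_smul] at h
    have h1 := ih (HMat.eq_zero_of_smul PowerSeries.X_ne_zero h)
    rwa [hB', PowerSeries.coeff_mk] at h1

theorem ordered_injective : Function.Injective ordered := by
  rw [injective_iff_map_eq_zero]
  exact fun B hB => eq_zero_of_heisMat_ordered_eq_zero (by rw [hB, map_zero])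

theorem heisMat_injective : Function.Injective heisMat := by
  rw [injective_iff_map_eq_zero]
  intro x hx
  obtain ⟨B, rfl⟩ := ordered_surjective x
  rw [eq_zero_of_heisMat_ordered_eq_zero hx, map_zero]

/-! ### The operator and matrix algebras as faithful images of `Heis`. -/

/-- The substitution of `â†` and `-i ħ â` for `x̂` and `p̂`. -/
def heisOp : Heis →ₐ[HSer] Module.End HSer Fock := matAct.comp heisMat

theorem heisOp_injective : Function.Injective heisOp := matAct_injective.comp heisMat_injective

theorem isOpSeries_heisOp (c : NC) : IsOpSeries c (heisOp (Heis.mk c)) := isOpSeries_matAct c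

theorem heisOp_xhat : heisOp xhat = creat :=
  (congrArg matAct heisMat_xhat).trans matAct_raiseMat

theorem heisOp_phat : heisOp phat = momOp :=
  (congrArg matAct heisMat_phat).trans matAct_momMat

/-- A formal series has at most one value, so the operators given by series are exactly the image of
`Heis`; this is why they form a subalgebra. -/
theorem coe_range_heisOp : (heisOp.range : Set (Module.End HSer Fock)) = opSeriesSet := by
  ext T
  constructor
  · rintro ⟨x, rfl⟩
    obtain ⟨c, rfl⟩ := Heis.mk_surjective x
    exact ⟨c, isOpSeries_heisOp c⟩
  · rintro ⟨c, hc⟩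
    exact ⟨Heis.mk c, (isOpSeries_heisOp c).unique hc⟩

theorem coe_range_heisMat : (heisMat.range : Set HMat) = matSeriesSet := by
  ext A
  constructor
  · rintro ⟨x, rfl⟩
    obtain ⟨c, rfl⟩ := Heis.mk_surjective x
    exact ⟨c, isMatSeries_matEval c⟩
  · rintro ⟨c, hc⟩
    exact ⟨Heis.mk c, (isMatSeries_matEval c).unique hc⟩

/-- The isomorphism of `Heis` with the algebra of operators. -/
def heisEquivOp : Heis ≃ₐ[HSer] heisOp.range := AlgEquiv.ofInjective heisOp heisOp_injective

/-- The isomorphism of `Heis` with the algebra of matrices. -/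
def heisEquivMat : Heis ≃ₐ[HSer] heisMat.range := AlgEquiv.ofInjective heisMat heisMat_injective

theorem coe_heisEquivOp (x : Heis) : (heisEquivOp x : Module.End HSer Fock) = heisOp x := rfl

/-! ### Coefficients -/

theorem derivZero_eq (f : PowerSeries ℂ) (s : ℕ) :
    derivZero f s = (s.factorial : ℂ) * PowerSeries.coeff s f := by
  rw [derivZero, PowerSeries.constantCoeff_iterate_derivative]

theorem gcoef_eq (f : PowerSeries ℂ) (m n s : ℕ) :
    gcoef f m n s = (-1) ^ s * (multi m n s * derivZero f s) := by
  rw [gcoef, multi]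
  ring

theorem factorial_mul_multi {m n s : ℕ} (hm : s ≤ m) (hn : s ≤ n) :
    (s.factorial : ℂ) * multi m n s = (m.descFactorial s * n.descFactorial s : ℕ) := by
  rw [multi, ← Nat.factorial_mul_descFactorial hm, ← Nat.factorial_mul_descFactorial hn]
  have h1 : (s.factorial : ℂ) ≠ 0 := Nat.cast_ne_zero.2 (Nat.factorial_ne_zero _)
  have h2 : ((m - s).factorial : ℂ) ≠ 0 := Nat.cast_ne_zero.2 (Nat.factorial_ne_zero _)
  have h3 : ((n - s).factorial : ℂ) ≠ 0 := Nat.cast_ne_zero.2 (Nat.factorial_ne_zero _)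
  push_cast
  field_simp

theorem multi_mul_derivZero (f : PowerSeries ℂ) {m n s : ℕ} (hm : s ≤ m) (hn : s ≤ n) :
    multi m n s * derivZero f s =
      (m.descFactorial s * n.descFactorial s : ℕ) * PowerSeries.coeff s f := by
  rw [derivZero_eq, ← factorial_mul_multi hm hn]
  ring

/-- Uses `(-i)(-ħ) = iħ`, which brings the coefficients of the special orderings to powers of `iħ`.
-/
theorem cst_mul_neg_hbar_pow {a z d : ℂ} {s : ℕ} (h : d = z * (-Complex.I) ^ s) :
    cst (a * d) * (-hbar) ^ s = cst (a * z) * (cst Complex.I * hbar) ^ s := by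
  have h1 : (-hbar) ^ s = cst ((-1) ^ s) * hbar ^ s := by
    rw [neg_pow hbar, cst_pow]
    simp
  rw [h, h1, mul_pow, ← cst_pow, ← mul_assoc, ← mul_assoc (cst (a * z)), ← cst_mul, ← cst_mul]
  congr 2
  rw [mul_assoc, mul_assoc, mul_assoc, ← mul_pow]
  norm_num

/-- The hockey-stick identity for falling factorials, source of the factor `1/(s + 1)` in
Born–Jordan ordering. -/
theorem sum_descFactorial (m s : ℕ) :
    (∑ k ∈ Finset.range (m + 1), k.descFactorial s) * (s + 1) = (m + 1) * m.descFactorial s := by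
  rw [← Nat.succ_descFactorial_succ]
  induction m with
  | zero => rcases s with _ | s <;> simp
  | succ m ih =>
    rw [Finset.sum_range_succ, add_mul, ih, Nat.succ_descFactorial_succ (m + 1),
      Nat.descFactorial_succ (m + 1)]
    by_cases h : s ≤ m + 1
    · obtain ⟨k, hk⟩ := Nat.exists_eq_add_of_le h
      rw [hk, Nat.add_sub_cancel_left]
      ring
    · rw [Nat.descFactorial_eq_zero_iff_lt.2 (not_le.1 h)]
      simp

theorem sum_descFactorial_sub (m s : ℕ) :
    (∑ k ∈ Finset.range (m + 1), (m - k).descFactorial s) * (s + 1) =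
      (m + 1) * m.descFactorial s := by
  rw [← sum_descFactorial, ← Finset.sum_range_reflect (fun k => k.descFactorial s)]
  simp

/-! ### Operators on monomials -/

theorem dxdp_monomial (m n : ℕ) : dxdp (pv ^ m * xv ^ n) =
    ((m * n : ℕ) : HSer) • (pv ^ (m - 1) * xv ^ (n - 1)) := by
  rw [dxdp, Module.End.mul_apply, dpLin_apply, dp_monomial, map_smul, dxLin_apply, dx_monomial,
    smul_smul, Nat.cast_mul]

theorem dxdp_pow_monomial (m n s : ℕ) : (dxdp ^ s) (pv ^ m * xv ^ n) =
    ((m.descFactorial s * n.descFactorial s : ℕ) : HSer) • (pv ^ (m - s) * xv ^ (n - s)) := by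
  induction s with
  | zero => simp
  | succ s ih =>
    rw [pow_succ', Module.End.mul_apply, ih, map_smul, dxdp_monomial, smul_smul, Nat.sub_sub,
      Nat.sub_sub, ← Nat.cast_mul, Nat.descFactorial_succ, Nat.descFactorial_succ]
    congr 2
    ring

/-- Falling factorials kill every term with `s > min m n`, so the cutoff is free and the truncated
exponents there are harmless. A common cutoff later allows sums over different powers of `p` to be
interchanged. -/
theorem diffOp_monomial (φ : PowerSeries ℂ) {m n N : ℕ} (hN : min m n < N) :
    diffOp φ (pv ^ m * xv ^ n) = ∑ s ∈ Finset.range N,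
      (cst ((m.descFactorial s * n.descFactorial s : ℕ) * PowerSeries.coeff s φ) * (-hbar) ^ s) •
        (pv ^ (m - s) * xv ^ (n - s)) := by
  rw [diffOp_eq, hbarSum_eq_sum _ N]
  · refine Finset.sum_congr rfl fun s _ => ?_
    rw [LinearMap.smul_apply, dxdp_pow_monomial, smul_smul, smul_smul, neg_pow hbar,
      show (-1 : HSer) ^ s = cst ((-1) ^ s) by simp, cst_mul, cst_mul,
      ← map_natCast (PowerSeries.C : ℂ →+* HSer)]
    congr 1
    ring
  · intro s hs
    have h : m.descFactorial s * n.descFactorial s = 0 := by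
      rcases min_lt_iff.1 (hN.trans_le hs) with h | h
      · rw [Nat.descFactorial_eq_zero_iff_lt.2 h, zero_mul]
      · rw [Nat.descFactorial_eq_zero_iff_lt.2 h, mul_zero]
    rw [LinearMap.smul_apply, dxdp_pow_monomial, h, Nat.cast_zero, zero_smul, smul_zero]

theorem diffOp_monomial_eq_sum_multi (f : PowerSeries ℂ) (m n : ℕ) :
    diffOp f (pv ^ m * xv ^ n) = ∑ s ∈ Finset.range (min m n + 1),
      (cst (multi m n s * derivZero f s) * (-hbar) ^ s) • (pv ^ (m - s) * xv ^ (n - s)) := by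
  rw [diffOp_monomial f (Nat.lt_succ_self _)]
  refine Finset.sum_congr rfl fun s hs => ?_
  have hs := Finset.mem_range.1 hs
  rw [multi_mul_derivZero f (by omega) (by omega)]

theorem diffOp_of_dxdp_eq_zero (φ : PowerSeries ℂ) {A : Phase} (h : dxdp A = 0) :
    diffOp φ A = cst (PowerSeries.constantCoeff φ) • A := by
  rw [diffOp_eq, hbarSum_eq_sum _ 1]
  · simp
  · intro r hr
    obtain ⟨r, rfl⟩ := Nat.exists_eq_add_of_le' hr
    rw [LinearMap.smul_apply, pow_succ dxdp, Module.End.mul_apply, h, map_zero, smul_zero]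

theorem coeff_dxdp (A : Phase) (e : Fin 2 →₀ ℕ) : MvPowerSeries.coeff e (dxdp A) =
    ((e 1 + 1 : ℕ) * (e 0 + 1 : ℕ) : HSer) *
      MvPowerSeries.coeff (e + Finsupp.single 0 1 + Finsupp.single 1 1) A := by
  rw [dxdp, Module.End.mul_apply, dxLin_apply, dpLin_apply, MvPowerSeries.coeff_pderiv,
    MvPowerSeries.coeff_pderiv]
  simp only [Finsupp.add_apply, Finsupp.single_apply]
  simp
  ring

theorem coeff_dxdp_pow (A : Phase) (s : ℕ) (e : Fin 2 →₀ ℕ) :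
    MvPowerSeries.coeff e ((dxdp ^ s) A) =
      (((e 1 + s).descFactorial s * (e 0 + s).descFactorial s : ℕ) : HSer) *
        MvPowerSeries.coeff (e + Finsupp.single 0 s + Finsupp.single 1 s) A := by
  induction s generalizing e with
  | zero => simp
  | succ s ih =>
    have h : e + Finsupp.single 0 1 + Finsupp.single 1 1 + Finsupp.single 0 s +
        Finsupp.single 1 s = e + Finsupp.single 0 (s + 1) + Finsupp.single 1 (s + 1) := by
      ext i
      fin_cases i <;> simp <;> ring
    have h0 : (e + Finsupp.single 0 1 + Finsupp.single 1 1 : Fin 2 →₀ ℕ) 0 = e 0 + 1 := by simp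
    have h1 : (e + Finsupp.single 0 1 + Finsupp.single 1 1 : Fin 2 →₀ ℕ) 1 = e 1 + 1 := by simp
    have h2 : ∀ k : ℕ, (k + (s + 1)).descFactorial (s + 1) =
        (k + 1) * (k + 1 + s).descFactorial s := by
      intro k
      rw [Nat.descFactorial_succ, show k + (s + 1) - s = k + 1 by omega,
        show k + (s + 1) = k + 1 + s by omega]
    rw [pow_succ', Module.End.mul_apply, coeff_dxdp, ih, h, h0, h1, h2, h2]
    push_cast
    ring

/-- The generalized Weyl map is `f(-ħ ∂²/∂x∂p)` followed by normal ordering. -/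
theorem weylMap_eq (f : PowerSeries ℂ) (A : Phase) : weylMap f A = ordered (diffOp f A) := by
  rw [weylMap, ordered_apply, diffOp_eq]
  congr 3
  funext s
  refine MvPowerSeries.ext fun e => ?_
  rw [LinearMap.smul_apply, MvPowerSeries.coeff_smul, coeff_dxdp_pow, ← mul_assoc,
    ← map_natCast (PowerSeries.C : ℂ →+* HSer), ← map_mul]
  refine congrArg (fun z => cst z * _) ?_
  rw [gcoef_eq, multi_mul_derivZero f (Nat.le_add_left _ _) (Nat.le_add_left _ _)]
  ring

/-! ### The generalized Weyl isomorphism -/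

/-- The generalized Weyl map as a linear isomorphism. -/
def weylEquiv (f : PowerSeries ℂ) (hf : PowerSeries.constantCoeff f = 1) :
    Phase ≃ₗ[HSer] Heis :=
  LinearEquiv.ofBijective (ordered ∘ₗ diffOpLin f) (by
    have h1 : f⁻¹ * f = 1 := PowerSeries.inv_mul_cancel f (by rw [hf]; exact one_ne_zero)
    have h2 : f * f⁻¹ = 1 := PowerSeries.mul_inv_cancel f (by rw [hf]; exact one_ne_zero)
    constructor
    · refine ordered_injective.comp fun A B h => ?_
      have h : diffOp f A = diffOp f B := h
      rw [← diffOp_mul_cancel h1 A, h, diffOp_mul_cancel h1]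
    · refine ordered_surjective.comp fun A => ⟨diffOp f⁻¹ A, ?_⟩
      exact diffOp_mul_cancel h2 A)

section weylEquiv

variable {f : PowerSeries ℂ} (hf : PowerSeries.constantCoeff f = 1)

theorem weylEquiv_apply (A : Phase) : weylEquiv f hf A = ordered (diffOp f A) := rfl

theorem weylEquiv_mul (A B : Phase) :
    weylEquiv f hf A * weylEquiv f hf B = weylEquiv f hf (gstar f A B) := by
  have h : f * f⁻¹ = 1 := PowerSeries.mul_inv_cancel f (by rw [hf]; exact one_ne_zero)
  rw [weylEquiv_apply, weylEquiv_apply, weylEquiv_apply, ordered_mul, gstar_eq,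
    diffOp_mul_cancel h]

theorem weylEquiv_of_dxdp_eq_zero {A : Phase} (h : dxdp A = 0) :
    weylEquiv f hf A = ordered A := by
  rw [weylEquiv_apply, diffOp_of_dxdp_eq_zero f h, hf, cst, map_one, one_smul]

theorem weylEquiv_one : weylEquiv f hf 1 = 1 := by
  rw [weylEquiv_of_dxdp_eq_zero hf (by simp [dxdp, dpLin_apply]), ordered_one]

theorem weylEquiv_monomial (m n : ℕ) : weylEquiv f hf (pv ^ m * xv ^ n) =
    ∑ s ∈ Finset.range (min m n + 1), (cst (multi m n s * derivZero f s) * (-hbar) ^ s) •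
      (phat ^ (m - s) * xhat ^ (n - s)) := by
  rw [weylEquiv_apply, diffOp_monomial_eq_sum_multi, map_sum]
  simp only [map_smul, ordered_monomial]

end weylEquiv

/-- Associativity and the unit laws are pulled back from `Heis` through the injective,
multiplicative Weyl map. -/
theorem gstar_assoc {f : PowerSeries ℂ} (hf : PowerSeries.constantCoeff f = 1)
    (A B C : Phase) :
    gstar f (gstar f A B) C = gstar f A (gstar f B C) := by
  apply (weylEquiv f hf).injective
  rw [← weylEquiv_mul, ← weylEquiv_mul, ← weylEquiv_mul, ← weylEquiv_mul, mul_assoc]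

theorem one_gstar {f : PowerSeries ℂ} (hf : PowerSeries.constantCoeff f = 1) (A : Phase) :
    gstar f 1 A = A := by
  apply (weylEquiv f hf).injective
  rw [← weylEquiv_mul, weylEquiv_one, one_mul]

theorem gstar_one {f : PowerSeries ℂ} (hf : PowerSeries.constantCoeff f = 1) (A : Phase) :
    gstar f A 1 = A := by
  apply (weylEquiv f hf).injective
  rw [← weylEquiv_mul, weylEquiv_one, mul_one]

/-- The generalized Weyl map with values in matrices, as a linear isomorphism. -/
def weylMatEquiv (f : PowerSeries ℂ) (hf : PowerSeries.constantCoeff f = 1) :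
    Phase ≃ₗ[HSer] heisMat.range :=
  (weylEquiv f hf).trans heisEquivMat.toLinearEquiv

theorem coe_weylMatEquiv {f : PowerSeries ℂ} (hf : PowerSeries.constantCoeff f = 1) (A : Phase) :
    (weylMatEquiv f hf A : HMat) = heisMat (weylEquiv f hf A) := rfl

/-! ### Weyl ordering -/

theorem poissonPow_zero_left (r : ℕ) (B : Phase) : poissonPow r 0 B = 0 := by
  rw [poissonPow_eq, TensorProduct.zero_tmul, map_zero, map_zero]

/-- Only the term `r = 0` survives: for `r = 1` the Poisson bracket of a linear form with its own
power is zero, and for `r ≥ 2` the second derivatives of a linear form are zero. Hence Moyal powers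
of linear forms are ordinary powers. -/
theorem moyal_linear_form_pow (u v : HSer) (N : ℕ) :
    moyal (u • xv + v • pv) ((u • xv + v • pv) ^ N) = (u • xv + v • pv) ^ (N + 1) := by
  have hx : dx (u • xv + v • pv) = u • 1 := by simp
  have hp : dp (u • xv + v • pv) = v • 1 := by simp
  rw [moyal, hbarSum_eq_sum _ 1]
  · simp [poissonPow, pow_succ']
  · intro r hr
    obtain ⟨r, rfl⟩ := Nat.exists_eq_add_of_le' hr
    rw [poissonPow, hx, hp]
    rcases r with _ | r
    · rw [poissonPow, poissonPow, dp, dx, MvPowerSeries.pderiv_pow, MvPowerSeries.pderiv_pow]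
      change cst _ • ((u • 1) * (_ * dp (u • xv + v • pv)) -
        (v • 1) * (_ * dx (u • xv + v • pv))) = 0
      rw [hx, hp, mul_left_comm, mul_comm (u • (1 : Phase)), mul_left_comm (v • (1 : Phase)),
        sub_self, smul_zero]
    · rw [poissonPow, poissonPow]
      simp [poissonPow_zero_left]

theorem gstar_eq_moyal {f : PowerSeries ℂ} (h : alpha f = 1) (A B : Phase) :
    gstar f A B = moyal A B := by
  rw [gstar, h, inv_one, diffOp_one, diffOp_one, diffOp_one]

theorem weylEquiv_linear_form_pow {f : PowerSeries ℂ} (hf : PowerSeries.constantCoeff f = 1)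
    (h : alpha f = 1) (u v : HSer) (N : ℕ) :
    weylEquiv f hf ((u • xv + v • pv) ^ N) = (u • xhat + v • phat) ^ N := by
  have hx : ordered xv = xhat := by simpa using ordered_monomial 0 1
  have hp : ordered pv = phat := by simpa using ordered_monomial 1 0
  have h1 : weylEquiv f hf (u • xv + v • pv) = u • xhat + v • phat := by
    rw [weylEquiv_of_dxdp_eq_zero hf, map_add, map_smul, map_smul, hx, hp]
    rw [dxdp, Module.End.mul_apply, dpLin_apply]
    simp [dxLin_apply]
  induction N with
  | zero => rw [pow_zero, pow_zero, weylEquiv_one]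
  | succ N ih => rw [← moyal_linear_form_pow, ← gstar_eq_moyal h, ← weylEquiv_mul, h1, ih,
      pow_succ']

/-! ### Standard ordering -/

theorem eq_alpha_mul_expSer (f : PowerSeries ℂ) : f = alpha f * expSer (-(Complex.I / 2)) := by
  rw [alpha, mul_assoc, expSer_mul, add_neg_cancel, expSer_zero, mul_one]

theorem derivZero_expSer (c : ℂ) (s : ℕ) : derivZero (expSer c) s = c ^ s := by
  rw [derivZero_eq, coeff_expSer, mul_div_cancel₀ _ (Nat.cast_ne_zero.2 (Nat.factorial_ne_zero s))]

theorem dxLin_pow_xv_pow (n r : ℕ) : (dxLin ^ r) (xv ^ n) =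
    (n.descFactorial r : HSer) • xv ^ (n - r) := by
  induction r with
  | zero => simp
  | succ r ih =>
    have h := dx_monomial 0 (n - r)
    rw [pow_zero, one_mul, one_mul] at h
    rw [pow_succ', Module.End.mul_apply, ih, map_smul, dxLin_apply, h, smul_smul, Nat.sub_sub,
      ← Nat.cast_mul, Nat.descFactorial_succ, mul_comm]

theorem dpLin_pow_pv_pow (m r : ℕ) : (dpLin ^ r) (pv ^ m) =
    (m.descFactorial r : HSer) • pv ^ (m - r) := by
  induction r with
  | zero => simp
  | succ r ih =>
    have h := dp_monomial (m - r) 0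
    rw [pow_zero, mul_one, mul_one] at h
    rw [pow_succ', Module.End.mul_apply, ih, map_smul, dpLin_apply, h, smul_smul, Nat.sub_sub,
      ← Nat.cast_mul, Nat.descFactorial_succ, mul_comm]

/-- Since `∂_x` sees only `x^n` and `∂_p` only `p^m`, the two derivatives merge into powers of
`∂²/∂x∂p` on the product. -/
theorem nstar_xv_pow_pv_pow (m n : ℕ) :
    nstar (xv ^ n) (pv ^ m) = diffOp (expSer (-Complex.I)) (pv ^ m * xv ^ n) := by
  rw [nstar, diffOp_eq]
  congr 1
  funext s
  rw [LinearMap.smul_apply, dxdp_pow_monomial, dxLin_pow_xv_pow, dpLin_pow_pv_pow, coeff_expSer,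
    smul_mul_smul_comm, ← Nat.cast_mul, mul_comm (n.descFactorial s), mul_comm (xv ^ _),
    ← mul_div_assoc, ← mul_pow, neg_one_mul, neg_neg]

theorem xhat_pow_mul_phat_pow (m n : ℕ) :
    xhat ^ n * phat ^ m = ordered (diffOp (expSer (-Complex.I)) (pv ^ m * xv ^ n)) := by
  have hx := ordered_monomial 0 n
  have hp := ordered_monomial m 0
  rw [pow_zero, pow_zero, one_mul, one_mul] at hx
  rw [pow_zero, pow_zero, mul_one, mul_one] at hp
  rw [← hx, ← hp, ordered_mul, nstar_xv_pow_pv_pow]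

/-! ### Symmetric ordering -/

theorem rescale_cos : PowerSeries.rescale (1 / 2 : ℂ) (PowerSeries.cos ℂ) =
    PowerSeries.C (1 / 2 : ℂ) * (expSer (Complex.I / 2) + expSer (-(Complex.I / 2))) := by
  ext n
  rw [PowerSeries.coeff_rescale, PowerSeries.coeff_C_mul, map_add, coeff_expSer, coeff_expSer,
    PowerSeries.cos, PowerSeries.coeff_mk]
  split_ifs with h
  · obtain ⟨k, rfl⟩ := h
    have h2 : (k + k) / 2 = k := by omega
    rw [h2, (Even.add_self k).neg_pow, div_pow Complex.I, ← two_mul, pow_mul Complex.I, Complex.I_sq]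
    simp
    ring
  · rw [(Nat.not_even_iff_odd.1 h).neg_pow]
    ring

theorem rescale_sin : PowerSeries.rescale (1 / 2 : ℂ) (PowerSeries.sin ℂ) =
    PowerSeries.C (-(Complex.I / 2)) *
      (expSer (Complex.I / 2) - expSer (-(Complex.I / 2))) := by
  ext n
  rw [PowerSeries.coeff_rescale, PowerSeries.coeff_C_mul, map_sub, coeff_expSer, coeff_expSer,
    PowerSeries.sin, PowerSeries.coeff_mk]
  split_ifs with h
  · rw [h.neg_pow]
    ring
  · obtain ⟨k, rfl⟩ := Nat.not_even_iff_odd.1 h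
    have h2 : (2 * k + 1) / 2 = k := by omega
    rw [h2, (odd_two_mul_add_one k).neg_pow, div_pow Complex.I, pow_succ Complex.I, pow_mul Complex.I,
      Complex.I_sq]
    have hI := Complex.I_mul_I
    simp
    linear_combination ((-1) ^ k / (2 ^ (2 * k + 1) * ((2 * k + 1).factorial : ℂ))) * hI

theorem diffOp_add (φ ψ : PowerSeries ℂ) (A : Phase) :
    diffOp (φ + ψ) A = diffOp φ A + diffOp ψ A := by
  simp only [diffOp_eq, map_add, mul_add, add_smul, LinearMap.add_apply, hbarSum_add]

theorem diffOp_C_mul (z : ℂ) (φ : PowerSeries ℂ) (A : Phase) :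
    diffOp (PowerSeries.C z * φ) A = cst z • diffOp φ A := by
  rw [diffOp_eq, diffOp_eq, ← hbarSum_smul]
  congr 1
  funext s
  rw [PowerSeries.coeff_C_mul, mul_left_comm, cst_mul z, mul_smul, LinearMap.smul_apply]

/-- This is `cos(y/2) exp(-iy/2) = (1 + exp(-iy)) / 2`, the mean of the series for anti-standard and
standard ordering. -/
theorem eq_of_alpha_eq_cos {f : PowerSeries ℂ}
    (h : alpha f = PowerSeries.rescale (1 / 2 : ℂ) (PowerSeries.cos ℂ)) :
    f = PowerSeries.C (1 / 2 : ℂ) * (1 + expSer (-Complex.I)) := by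
  rw [eq_alpha_mul_expSer f, h, rescale_cos, mul_assoc, add_mul, expSer_mul, expSer_mul,
    add_neg_cancel, expSer_zero, ← neg_add, add_halves]

theorem coeff_of_alpha_eq_sin {f : PowerSeries ℂ}
    (h : PowerSeries.C (1 / 2 : ℂ) * PowerSeries.X * alpha f =
      PowerSeries.rescale (1 / 2 : ℂ) (PowerSeries.sin ℂ)) (s : ℕ) :
    PowerSeries.coeff s f = (-Complex.I) ^ s / ((s + 1).factorial : ℂ) := by
  have h1 : PowerSeries.C (1 / 2 : ℂ) * (PowerSeries.X * f) =
      PowerSeries.C (-(Complex.I / 2)) * (1 - expSer (-Complex.I)) := by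
    have h2 := congrArg (· * expSer (-(Complex.I / 2))) h
    simp only [rescale_sin] at h2
    rw [mul_assoc _ (alpha f), ← eq_alpha_mul_expSer, mul_assoc, mul_assoc, sub_mul, expSer_mul,
      expSer_mul, add_neg_cancel, expSer_zero, ← neg_add, add_halves] at h2
    exact h2
  -- The factor `y` on the left shifts the index, so the coefficient of order `s + 1` isolates that
  -- of `f` at order `s`.
  have h3 := congrArg (PowerSeries.coeff (s + 1)) h1
  rw [PowerSeries.coeff_C_mul, PowerSeries.coeff_C_mul, PowerSeries.coeff_succ_X_mul, map_sub,
    PowerSeries.coeff_one, if_neg (Nat.succ_ne_zero s), coeff_expSer, pow_succ] at h3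
  have hI := Complex.I_mul_I
  linear_combination 2 * h3 - ((-Complex.I) ^ s / ((s + 1).factorial : ℂ)) * hI

/-! ### Born-Jordan ordering -/

theorem phat_pow_mul_xhat_pow_mul_phat_pow (m n k : ℕ) :
    phat ^ k * xhat ^ n * phat ^ m = ∑ s ∈ Finset.range (n + 1),
      (cst ((m.descFactorial s * n.descFactorial s : ℕ) *
        PowerSeries.coeff s (expSer (-Complex.I))) * (-hbar) ^ s) •
          (phat ^ (k + m - s) * xhat ^ (n - s)) := by
  rw [mul_assoc, xhat_pow_mul_phat_pow,
    diffOp_monomial _ ((min_le_right m n).trans_lt (Nat.lt_succ_self n)), map_sum,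
    Finset.mul_sum]
  refine Finset.sum_congr rfl fun s _ => ?_
  rw [map_smul, ordered_monomial, mul_smul_comm, ← mul_assoc, ← pow_add]
  -- For `s > m` the two truncated exponents may differ, but the coefficient is zero.
  by_cases h : s ≤ m
  · rw [Nat.add_sub_assoc h]
  · rw [Nat.descFactorial_eq_zero_iff_lt.2 (not_le.1 h)]
    simp

theorem ordered_diffOp_bornJordan {f : PowerSeries ℂ}
    (h : ∀ s, PowerSeries.coeff s f = (-Complex.I) ^ s / ((s + 1).factorial : ℂ)) (m n : ℕ) :
    ordered (diffOp f (pv ^ m * xv ^ n)) = cst (1 / (m + 1 : ℂ)) •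
      ∑ k ∈ Finset.range (m + 1), phat ^ k * xhat ^ n * phat ^ (m - k) := by
  have h1 : ∀ k ∈ Finset.range (m + 1), phat ^ k * xhat ^ n * phat ^ (m - k) =
      ∑ s ∈ Finset.range (n + 1), (cst (((m - k).descFactorial s * n.descFactorial s : ℕ) *
        PowerSeries.coeff s (expSer (-Complex.I))) * (-hbar) ^ s) •
          (phat ^ (m - s) * xhat ^ (n - s)) := by
    intro k hk
    have hk : k + (m - k) = m := by have := Finset.mem_range.1 hk; omega
    rw [phat_pow_mul_xhat_pow_mul_phat_pow, hk]
  -- All `k` share the cutoff `n + 1` and the monomials `p̂^(m-s) x̂^(n-s)`, so the average over `k`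
  -- affects only the scalar factors.
  rw [Finset.sum_congr rfl h1, Finset.sum_comm, Finset.smul_sum,
    diffOp_monomial _ ((min_le_right m n).trans_lt (Nat.lt_succ_self n)), map_sum]
  refine Finset.sum_congr rfl fun s _ => ?_
  rw [map_smul, ordered_monomial, ← Finset.sum_smul, ← Finset.sum_mul, smul_smul, ← cst_sum,
    ← mul_assoc, ← cst_mul, ← Finset.sum_mul, ← Nat.cast_sum, ← Finset.sum_mul, h, coeff_expSer]
  congr 3
  have h2 : ((∑ k ∈ Finset.range (m + 1), (m - k).descFactorial s : ℕ) : ℂ) * (s + 1) =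
      (m + 1) * m.descFactorial s := by exact_mod_cast sum_descFactorial_sub m s
  have hs : (s + 1 : ℂ) ≠ 0 := Nat.cast_add_one_ne_zero s
  have hm : (m + 1 : ℂ) ≠ 0 := Nat.cast_add_one_ne_zero m
  have hf : (s.factorial : ℂ) ≠ 0 := Nat.cast_ne_zero.2 (Nat.factorial_ne_zero _)
  rw [← eq_div_iff hs] at h2
  rw [Nat.cast_mul (∑ k ∈ Finset.range (m + 1), (m - k).descFactorial s), h2,
    Nat.factorial_succ]
  push_cast
  field_simp

end Moyal

end

/-! ### Assembly of the isomorphisms and the five orderings. -/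

open Moyal
theorem mainTheorem1 :
    ∃ (D : Subalgebra HSer (Module.End HSer Fock)) (M : Subalgebra HSer HMat),
      (D : Set (Module.End HSer Fock)) = opSeriesSet ∧ (M : Set HMat) = matSeriesSet ∧
      ∃ (L : Heis ≃ₐ[HSer] D) (ρ : D ≃ₐ[HSer] M),
        -- `L` is the substitution of `â†` for `x̂` and of `-iħâ` for `p̂`
        (∀ c : NC, IsOpSeries c (L (Heis.mk c) : Module.End HSer Fock)) ∧
        (L xhat : Module.End HSer Fock) = creat ∧ (L phat : Module.End HSer Fock) = momOp ∧
        -- `ρ` is the substitution of the standard matrices for `â†` and `-iħâ`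
        (∀ (c : NC) (T : D), IsOpSeries c (T : Module.End HSer Fock) →
          IsMatSeries c (ρ T : HMat)) ∧
        ∀ f : PowerSeries ℂ, PowerSeries.constantCoeff f = 1 →
          -- the generalized Moyal algebra
          (∀ A : Phase, diffOp (alpha f)⁻¹ (diffOp (alpha f) A) = A ∧
            diffOp (alpha f) (diffOp (alpha f)⁻¹ A) = A) ∧
          (∀ A B C : Phase, gstar f (gstar f A B) C = gstar f A (gstar f B C)) ∧
          (∀ A : Phase, gstar f 1 A = A ∧ gstar f A 1 = A) ∧
          ∃ (W : Phase ≃ₗ[HSer] Heis) (Wt : Phase ≃ₗ[HSer] M),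
            -- the generalized Weyl map
            (∀ A : Phase, W A = weylMap f A) ∧
            W 1 = 1 ∧
            (∀ m n : ℕ, W (pv ^ m * xv ^ n) = ∑ s ∈ Finset.range (min m n + 1),
              (cst (gcoef f m n s) * hbar ^ s) • (phat ^ (m - s) * xhat ^ (n - s))) ∧
            (∀ A B : Phase, W A * W B = W (gstar f A B)) ∧
            -- its composition with `L`
            (∀ m n : ℕ, (L (W (pv ^ m * xv ^ n)) : Module.End HSer Fock) =
              ∑ s ∈ Finset.range (min m n + 1),
                (cst (multi m n s * derivZero f s) * (-hbar) ^ s) •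
                  (momOp ^ (m - s) * creat ^ (n - s))) ∧
            -- the algebra isomorphism onto the matrix algebra
            (∀ A : Phase, Wt A = ρ (L (W A))) ∧
            Wt 1 = 1 ∧
            (∀ A B : Phase, Wt (gstar f A B) = Wt A * Wt B) ∧
            (∀ m n : ℕ, (Wt (pv ^ m * xv ^ n) : HMat) = ∑ s ∈ Finset.range (min m n + 1),
              (cst (multi m n s * derivZero f s) * (-hbar) ^ s) • Fmat (m - s) (n - s)) ∧
            -- Weyl ordering
            (alpha f = 1 →
              (∀ A B : Phase, gstar f A B = moyal A B) ∧
              (∀ (u v : HSer) (N : ℕ), W ((u • xv + v • pv) ^ N) = (u • xhat + v • phat) ^ N) ∧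
              ∀ m n : ℕ, (Wt (pv ^ m * xv ^ n) : HMat) = ∑ s ∈ Finset.range (min m n + 1),
                (cst (multi m n s / 2 ^ s) * (cst Complex.I * hbar) ^ s) •
                  Fmat (m - s) (n - s)) ∧
            -- standard ordering
            (alpha f = expSer (-(Complex.I / 2)) →
              ∀ m n : ℕ, W (pv ^ m * xv ^ n) = xhat ^ n * phat ^ m ∧
                (Wt (pv ^ m * xv ^ n) : HMat) = ∑ s ∈ Finset.range (min m n + 1),
                  (cst (multi m n s) * (cst Complex.I * hbar) ^ s) • Fmat (m - s) (n - s)) ∧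
            -- anti-standard ordering
            (alpha f = expSer (Complex.I / 2) →
              ∀ m n : ℕ, W (pv ^ m * xv ^ n) = phat ^ m * xhat ^ n ∧
                (Wt (pv ^ m * xv ^ n) : HMat) = Fmat m n) ∧
            -- symmetric ordering
            (alpha f = PowerSeries.rescale (1 / 2 : ℂ) (PowerSeries.cos ℂ) →
              ∀ m n : ℕ, W (pv ^ m * xv ^ n) =
                  cst (1 / 2) • (phat ^ m * xhat ^ n + xhat ^ n * phat ^ m) ∧
                (Wt (pv ^ m * xv ^ n) : HMat) = Fmat m n + ∑ s ∈ Finset.Icc 1 (min m n),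
                  (cst (multi m n s / 2) * (cst Complex.I * hbar) ^ s) •
                    Fmat (m - s) (n - s)) ∧
            -- Born-Jordan ordering: `α(y) = sin(y/2) / (y/2)`
            (PowerSeries.C (1 / 2 : ℂ) * PowerSeries.X * alpha f =
                PowerSeries.rescale (1 / 2 : ℂ) (PowerSeries.sin ℂ) →
              ∀ m n : ℕ, W (pv ^ m * xv ^ n) =
                  cst (1 / (m + 1 : ℂ)) • ∑ k ∈ Finset.range (m + 1),
                    phat ^ k * xhat ^ n * phat ^ (m - k) ∧
                (Wt (pv ^ m * xv ^ n) : HMat) = ∑ s ∈ Finset.range (min m n + 1),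
                  (cst (multi m n s / (s + 1 : ℂ)) * (cst Complex.I * hbar) ^ s) •
                    Fmat (m - s) (n - s)) := by
  -- `ρ` goes back to `Heis` by the inverse of `L` and then to matrices, so its being an isomorphism
  -- rests on both representations being faithful.
  refine ⟨heisOp.range, heisMat.range, coe_range_heisOp, coe_range_heisMat, heisEquivOp,
    heisEquivOp.symm.trans heisEquivMat, isOpSeries_heisOp, heisOp_xhat, heisOp_phat, ?_, ?_⟩
  · intro c T hT
    -- Any series representing `T` represents the same element of `Heis`, by uniqueness of formal
    -- sums and injectivity of `L`.
    have h1 : T = heisEquivOp (Heis.mk c) := Subtype.ext (hT.unique (isOpSeries_heisOp c))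
    rw [h1, AlgEquiv.trans_apply, AlgEquiv.symm_apply_apply]
    exact isMatSeries_matEval c
  intro f hf
  have hα : PowerSeries.constantCoeff (alpha f) ≠ 0 := by
    rw [constantCoeff_alpha, hf]
    exact one_ne_zero
  have hF : ∀ m n : ℕ, heisMat (phat ^ m * xhat ^ n) = Fmat m n := fun m n => by
    rw [map_mul, map_pow, map_pow, heisMat_phat, heisMat_xhat, Fmat]
  have hWt : ∀ m n : ℕ, heisMat (weylEquiv f hf (pv ^ m * xv ^ n)) =
      ∑ s ∈ Finset.range (min m n + 1),
        (cst (multi m n s * derivZero f s) * (-hbar) ^ s) • Fmat (m - s) (n - s) := by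
    intro m n
    rw [weylEquiv_monomial, map_sum]
    simp only [map_smul, hF]
  have hWt' : ∀ (z : ℕ → ℂ), (∀ s, derivZero f s = z s * (-Complex.I) ^ s) → ∀ m n : ℕ,
      heisMat (weylEquiv f hf (pv ^ m * xv ^ n)) = ∑ s ∈ Finset.range (min m n + 1),
        (cst (multi m n s * z s) * (cst Complex.I * hbar) ^ s) • Fmat (m - s) (n - s) := by
    intro z hz m n
    rw [hWt]
    exact Finset.sum_congr rfl fun s _ => by rw [cst_mul_neg_hbar_pow (hz s)]
  refine ⟨fun A => ⟨diffOp_mul_cancel (PowerSeries.inv_mul_cancel _ hα) A,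
    diffOp_mul_cancel (PowerSeries.mul_inv_cancel _ hα) A⟩, gstar_assoc hf,
    fun A => ⟨one_gstar hf A, gstar_one hf A⟩, weylEquiv f hf,
    weylMatEquiv f hf, fun A => (weylMap_eq f A).symm, weylEquiv_one hf, ?_, weylEquiv_mul hf, ?_,
    fun A => ?_, ?_, ?_, ?_, ?_, ?_, ?_, ?_, ?_⟩
  · intro m n
    rw [weylEquiv_monomial]
    refine Finset.sum_congr rfl fun s _ => ?_
    rw [gcoef_eq, mul_comm ((-1) ^ s), cst_mul (_ * _), cst_pow, mul_assoc, ← mul_pow]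
    simp
  · intro m n
    rw [coe_heisEquivOp, weylEquiv_monomial, map_sum]
    simp only [map_smul, map_mul, map_pow, heisOp_phat, heisOp_xhat]
  · rw [AlgEquiv.trans_apply, AlgEquiv.symm_apply_apply]
    rfl
  · exact Subtype.ext (by rw [coe_weylMatEquiv, weylEquiv_one, map_one, OneMemClass.coe_one])
  · intro A B
    exact Subtype.ext (by
      rw [MulMemClass.coe_mul, coe_weylMatEquiv, coe_weylMatEquiv, coe_weylMatEquiv,
        ← weylEquiv_mul, map_mul])
  · exact fun m n => (coe_weylMatEquiv hf _).trans (hWt m n)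
  · intro h
    refine ⟨gstar_eq_moyal h, weylEquiv_linear_form_pow hf h, fun m n => (coe_weylMatEquiv hf _).trans ?_⟩
    -- Here `f = exp(-iy/2)`.
    have hd : ∀ s, derivZero f s = 1 / 2 ^ s * (-Complex.I) ^ s := fun s => by
      rw [eq_alpha_mul_expSer f, h, one_mul, derivZero_expSer, ← neg_div, div_pow]
      ring
    simp only [hWt' _ hd, mul_one_div]
  · intro h m n
    have hf' : f = expSer (-Complex.I) := by
      rw [eq_alpha_mul_expSer f, h, expSer_mul, ← neg_add, add_halves]
    have hd : ∀ s, derivZero f s = 1 * (-Complex.I) ^ s := fun s => by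
      rw [hf', derivZero_expSer, one_mul]
    refine ⟨?_, (coe_weylMatEquiv hf _).trans ?_⟩
    · rw [weylEquiv_apply, xhat_pow_mul_phat_pow, hf']
    · simp only [hWt' _ hd, mul_one]
  · intro h m n
    have hf' : f = 1 := by
      rw [eq_alpha_mul_expSer f, h, expSer_mul, add_neg_cancel, expSer_zero]
    have hW : weylEquiv f hf (pv ^ m * xv ^ n) = phat ^ m * xhat ^ n := by
      rw [weylEquiv_apply, hf', diffOp_one, ordered_monomial]
    exact ⟨hW, (coe_weylMatEquiv hf _).trans (by rw [hW, hF])⟩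
  · intro h m n
    have hf' := eq_of_alpha_eq_cos h
    -- The constant `1` in `(1 + exp(-iy)) / 2` contributes only at `s = 0`, which is why the term
    -- `F^(m,n)` stands apart with coefficient `1`.
    have hd : ∀ s, derivZero f s = (if s = 0 then 1 else 1 / 2) * (-Complex.I) ^ s := fun s => by
      rw [derivZero_eq, hf', PowerSeries.coeff_C_mul, map_add, mul_left_comm, mul_add,
        ← derivZero_eq (expSer _), derivZero_expSer, PowerSeries.coeff_one]
      split_ifs with hs
      · rw [hs]
        norm_num
      · ring
    refine ⟨?_, (coe_weylMatEquiv hf _).trans ?_⟩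
    · have hlin : diffOp f (pv ^ m * xv ^ n) = cst (1 / 2) •
          (pv ^ m * xv ^ n + diffOp (expSer (-Complex.I)) (pv ^ m * xv ^ n)) := by
        conv_lhs => rw [hf', diffOp_C_mul, diffOp_add, diffOp_one]
      rw [weylEquiv_apply, hlin, map_smul, map_add, ordered_monomial, xhat_pow_mul_phat_pow]
    · rw [hWt' _ hd, Finset.sum_range_eq_add_Ico _ (Nat.succ_pos _)]
      congr 1
      · simp [multi, Nat.factorial_ne_zero]
      · refine Finset.sum_congr rfl fun s hs => ?_
        have hs : s ≠ 0 := by have := (Finset.mem_Ico.1 hs).1; omega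
        rw [if_neg hs, mul_one_div]
  · intro h m n
    have hc := coeff_of_alpha_eq_sin h
    have hd : ∀ s, derivZero f s = 1 / (s + 1 : ℂ) * (-Complex.I) ^ s := fun s => by
      have hs : (s + 1 : ℂ) ≠ 0 := Nat.cast_add_one_ne_zero s
      have hs' : (s.factorial : ℂ) ≠ 0 := Nat.cast_ne_zero.2 (Nat.factorial_ne_zero _)
      rw [derivZero_eq, hc, Nat.factorial_succ]
      push_cast
      field_simp
    refine ⟨ordered_diffOp_bornJordan hc m n, (coe_weylMatEquiv hf _).trans ?_⟩
    simp only [hWt' _ hd, mul_one_div]
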